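/- Let $K$ be a number field with ring of integers $\mathcal{O}_K$, let $S$ be a finite set of non-zero prime ideals of $\mathcal{O}_K$, and let $R=\mathcal{O}_S=\{a/b \mid a,b\in\mathcal{O}_K,\ b\neq 0,\ \text{every prime divisor of } b\mathcal{O}_K \text{ lies in } S\}$ be the ring of $S$-algebraic integers in $K$. Assume that $R$ has infinitely many units, and let $T\subset \mathrm{SL}_2(R)$ be a subset. Let $\Pi(T)$ denote the set of non-zero prime ideals $\mathcal{P}$ of $R$ such that the reduction homomorphism $\mathrm{SL}_2(R)\to\mathrm{SL}_2(R/\mathcal{P})$ maps every element of $T$ to a scalar matrix. Then $T$ normally generates $\mathrm{SL}_2(R)$ (that is, the smallest normal subgroup of $\mathrm{SL}_2(R)$ containing $T$ is $\mathrm{SL}_2(R)$ itself) if and only if $\Pi(T)=\emptyset$ and the image of $T$ in the abelianization of $\mathrm{SL}_2(R)$ generates the abelianization. -/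

import Mathlib

open scoped MatrixGroups

/-- For a set `T` of matrices in `SL₂(R)`, the set `Π(T)` of all non-zero prime ideals `P` of `R`
such that the reduction `SL₂(R) → SL₂(R / P)` sends every element of `T` to a scalar matrix. -/
def scalarPrimes {R : Type*} [CommRing R] (T : Set SL(2, R)) : Set (Ideal R) :=
  {P | P.IsPrime ∧ P ≠ ⊥ ∧ ∀ A ∈ T, ∃ c : R ⧸ P,
    (Matrix.SpecialLinearGroup.map (Ideal.Quotient.mk P) A : Matrix (Fin 2) (Fin 2) (R ⧸ P)) =
      Matrix.scalar (Fin 2) c}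

/-- A subset `T` of a group `G` normally generates `G` if the smallest normal subgroup
containing `T` is `G`. -/
def NormallyGenerates {G : Type*} [Group G] (T : Set G) : Prop :=
  Subgroup.normalClosure T = ⊤

/-! Necessity holds because matrices that are scalar modulo `P` form a proper normal subgroup. For
sufficiency, let `N` be the normal closure of `T` and `Q = SL₂(R)/N`; the abelianization hypothesis
says that `Q` is perfect. The aim is to show that `Q` is also abelian, hence trivial.

Write `Γ(I)` for `principal I`. Every `Γ(I)` with `I ≠ 0` maps onto `Q` (`map_principal_eq_top`). At
a prime, nonscalarity of `N` makes the Borel subgroup modulo `P` surject, and its second derived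
group lies in `Γ(P)`. Composite ideals follow from `[Γ(I), Γ(J)] ≤ Γ(IJ)` and perfectness.

Let `germCentralizer K N` be the group of `γ ∈ SL₂(K)` whose commutators with some `Γ(m)` lie in
`N`. If it contains some `Γ(m)`, it contains `SL₂(R) = N Γ(m)`. Each `g ∈ SL₂(R)` then commutes
modulo `N` with some `Γ(k)`, which covers `Q`, so `Q` is abelian (`eq_top_of_not_scalar`).

To find `Γ(m)` there, a unit `u` of infinite order gives `upper (q t) ∈ N` for some `q` and all `t`
(`exists_upper_mem`). Elementary operations turn the first entry of a matrix in a congruence coset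
into a rational prime `r` in a chosen residue class (`exists_prime_eq_add`, resting on Dirichlet's
theorem over `ℤ`). If `v ≡ 1 mod r`, conjugation by `diag v` changes such a matrix only by
elementary factors. Since `u ^ |GL_d(𝔽_r)| ≡ 1 mod r`, a good class of `r` (`exists_residue`) makes
one fixed power of `diag u` commute with the coset modulo `N`. The same holds after conjugation by
`upper (t / p)`. Comparing different `t` puts `upper (q t / p)` in the germ centralizer for all
large primes `p`, and an LDU decomposition with pivot `r` then yields `Γ(m)`. -/

namespace SL2

/-! ### Matrix calculus, congruence subgroups and their commutators -/

section Basic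

variable {A : Type*} [CommRing A]

theorem ext {X Y : SL(2, A)} (h00 : X 0 0 = Y 0 0) (h01 : X 0 1 = Y 0 1) (h10 : X 1 0 = Y 1 0)
    (h11 : X 1 1 = Y 1 1) : X = Y := by
  ext i j
  fin_cases i <;> fin_cases j <;> assumption

/-- The matrix with rows `(a, b)` and `(c, d)`. -/
def mk (a b c d : A) (h : a * d - b * c = 1) : SL(2, A) :=
  ⟨!![a, b; c, d], by rw [Matrix.det_fin_two_of, h]⟩

section mk
variable (a b c d : A) (h : a * d - b * c = 1)
@[simp] theorem mk_00 : mk a b c d h 0 0 = a := rfl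
@[simp] theorem mk_01 : mk a b c d h 0 1 = b := rfl
@[simp] theorem mk_10 : mk a b c d h 1 0 = c := rfl
@[simp] theorem mk_11 : mk a b c d h 1 1 = d := rfl
end mk

theorem det_eq (X : SL(2, A)) : X 0 0 * X 1 1 - X 0 1 * X 1 0 = 1 := by
  rw [← Matrix.det_fin_two, X.det_coe]

section entries
variable (X Y : SL(2, A))

@[simp] theorem mul_00 : (X * Y) 0 0 = X 0 0 * Y 0 0 + X 0 1 * Y 1 0 := by
  simp [Matrix.mul_apply, Fin.sum_univ_two]
@[simp] theorem mul_01 : (X * Y) 0 1 = X 0 0 * Y 0 1 + X 0 1 * Y 1 1 := by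
  simp [Matrix.mul_apply, Fin.sum_univ_two]
@[simp] theorem mul_10 : (X * Y) 1 0 = X 1 0 * Y 0 0 + X 1 1 * Y 1 0 := by
  simp [Matrix.mul_apply, Fin.sum_univ_two]
@[simp] theorem mul_11 : (X * Y) 1 1 = X 1 0 * Y 0 1 + X 1 1 * Y 1 1 := by
  simp [Matrix.mul_apply, Fin.sum_univ_two]
@[simp] theorem inv_00 : X⁻¹ 0 0 = X 1 1 := by
  simp [Matrix.SpecialLinearGroup.SL2_inv_expl]
@[simp] theorem inv_01 : X⁻¹ 0 1 = - X 0 1 := by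
  simp [Matrix.SpecialLinearGroup.SL2_inv_expl]
@[simp] theorem inv_10 : X⁻¹ 1 0 = - X 1 0 := by
  simp [Matrix.SpecialLinearGroup.SL2_inv_expl]
@[simp] theorem inv_11 : X⁻¹ 1 1 = X 0 0 := by
  simp [Matrix.SpecialLinearGroup.SL2_inv_expl]
@[simp] theorem one_00 : (1 : SL(2, A)) 0 0 = 1 := by simp
@[simp] theorem one_01 : (1 : SL(2, A)) 0 1 = 0 := by simp
@[simp] theorem one_10 : (1 : SL(2, A)) 1 0 = 0 := by simp
@[simp] theorem one_11 : (1 : SL(2, A)) 1 1 = 1 := by simp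
@[simp] theorem map_entry {B : Type*} [CommRing B] (f : A →+* B) (i j : Fin 2) :
    Matrix.SpecialLinearGroup.map f X i j = f (X i j) := rfl
end entries

/-- The upper unipotent matrix with off-diagonal entry `t`. -/
def upper (t : A) : SL(2, A) := mk 1 t 0 1 (by ring)

/-- The lower unipotent matrix with off-diagonal entry `t`. -/
def lower (t : A) : SL(2, A) := mk 1 0 t 1 (by ring)

/-- The diagonal matrix with entries `v` and `v⁻¹`. -/
def diag (v : Aˣ) : SL(2, A) := mk v 0 0 (↑v⁻¹ : A) (by simp)

section elementary
variable (t : A) (v : Aˣ)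
@[simp] theorem upper_00 : upper t 0 0 = 1 := rfl
@[simp] theorem upper_01 : upper t 0 1 = t := rfl
@[simp] theorem upper_10 : upper t 1 0 = 0 := rfl
@[simp] theorem upper_11 : upper t 1 1 = 1 := rfl
@[simp] theorem lower_00 : lower t 0 0 = 1 := rfl
@[simp] theorem lower_01 : lower t 0 1 = 0 := rfl
@[simp] theorem lower_10 : lower t 1 0 = t := rfl
@[simp] theorem lower_11 : lower t 1 1 = 1 := rfl
@[simp] theorem diag_00 : diag v 0 0 = v := rfl
@[simp] theorem diag_01 : diag v 0 1 = 0 := rfl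
@[simp] theorem diag_10 : diag v 1 0 = 0 := rfl
@[simp] theorem diag_11 : diag v 1 1 = (↑v⁻¹ : A) := rfl
end elementary

theorem upper_add (s t : A) : upper (s + t) = upper s * upper t := by
  apply ext <;> simp [add_comm]

theorem upper_neg (t : A) : upper (-t) = (upper t)⁻¹ := by
  apply ext <;> simp

theorem diag_mul (v w : Aˣ) : diag (v * w) = diag v * diag w := by
  apply ext <;> simp [mul_comm]

theorem diag_conj_upper (v : Aˣ) (t : A) :
    diag v * upper t * (diag v)⁻¹ = upper (v ^ 2 * t) := by
  apply ext <;> simp; ring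

theorem diag_conj_lower (v : Aˣ) (t : A) :
    diag v * lower t * (diag v)⁻¹ = lower ((↑v⁻¹ : A) ^ 2 * t) := by
  apply ext <;> simp; ring

/-- The Weyl element. -/
def weyl : SL(2, A) := mk 0 1 (-1) 0 (by ring)

theorem weyl_conj_upper (t : A) : weyl * upper t * weyl⁻¹ = lower (-t) := by
  apply ext <;> simp [weyl]

section map
variable {B : Type*} [CommRing B] (f : A →+* B)

theorem map_upper (t : A) : Matrix.SpecialLinearGroup.map f (upper t) = upper (f t) := by
  apply ext <;> simp

theorem map_diag (v : Aˣ) :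
    Matrix.SpecialLinearGroup.map f (diag v) = diag (Units.map (f : A →* B) v) := by
  apply ext <;> simp

end map

/-- The principal congruence subgroup of level `I`. -/
def principal (I : Ideal A) : Subgroup SL(2, A) :=
  (Matrix.SpecialLinearGroup.map (n := Fin 2) (Ideal.Quotient.mk I)).ker

instance (I : Ideal A) : (principal I).Normal := by
  unfold principal; infer_instance

theorem mem_principal {I : Ideal A} {X : SL(2, A)} :
    X ∈ principal I ↔ X 0 0 - 1 ∈ I ∧ X 0 1 ∈ I ∧ X 1 0 ∈ I ∧ X 1 1 - 1 ∈ I := by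
  unfold principal
  rw [MonoidHom.mem_ker]
  simp only [← Ideal.Quotient.eq_zero_iff_mem, map_sub, map_one, sub_eq_zero]
  constructor
  · intro h
    refine ⟨?_, ?_, ?_, ?_⟩ <;> rw [← map_entry, h] <;> simp
  · rintro ⟨h1, h2, h3, h4⟩
    apply ext <;> simp [h1, h2, h3, h4]

theorem principal_mono {I J : Ideal A} (h : I ≤ J) : principal I ≤ principal J := fun X hX ↦ by
  rw [mem_principal] at hX ⊢
  exact ⟨h hX.1, h hX.2.1, h hX.2.2.1, h hX.2.2.2⟩

/-- `XY - YX = (X - 1)(Y - 1) - (Y - 1)(X - 1)` has entries in `I * J`. -/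
theorem commutator_principal_le (I J : Ideal A) :
    ⁅principal I, principal J⁆ ≤ principal (I * J) := by
  rw [Subgroup.commutator_le]
  intro X hX Y hY
  unfold principal
  rw [MonoidHom.mem_ker, map_commutatorElement, commutatorElement_eq_one_iff_mul_comm, ← map_mul,
    ← map_mul]
  rw [mem_principal] at hX hY
  obtain ⟨hX1, hX2, hX3, hX4⟩ := hX
  obtain ⟨hY1, hY2, hY3, hY4⟩ := hY
  have key : ∀ i j, (X * Y) i j - (Y * X) i j ∈ I * J := by
    intro i j
    have m := fun {x y : A} (hx : x ∈ I) (hy : y ∈ J) ↦ Ideal.mul_mem_mul hx hy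
    fin_cases i <;> fin_cases j <;>
      simp only [Fin.zero_eta, Fin.mk_one, Fin.isValue, mul_00, mul_01, mul_10, mul_11]
    · convert sub_mem (m hX2 hY3) (m hX3 hY2) using 1; ring
    · convert sub_mem (add_mem (m hX1 hY2) (m hX2 hY4)) (add_mem (m hX2 hY1) (m hX4 hY2)) using 1
      ring
    · convert sub_mem (add_mem (m hX3 hY1) (m hX4 hY3)) (add_mem (m hX1 hY3) (m hX3 hY4)) using 1
      ring
    · convert sub_mem (m hX3 hY2) (m hX2 hY3) using 1; ring
  apply ext <;> simp only [map_entry] <;> exact Ideal.Quotient.eq.2 (key _ _)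

/-- The matrices that are upper triangular modulo `I`. -/
def borel (I : Ideal A) : Subgroup SL(2, A) where
  carrier := {X | X 1 0 ∈ I}
  mul_mem' {X Y} hX hY := by
    simp only [Set.mem_ofPred_eq, mul_10] at *
    exact add_mem (I.mul_mem_right _ hX) (I.mul_mem_left _ hY)
  one_mem' := by simp
  inv_mem' {X} hX := by simpa using hX

/-- The matrices that are upper unitriangular modulo `I`. -/
def unitriangular (I : Ideal A) : Subgroup SL(2, A) where
  carrier := {X | X 1 0 ∈ I ∧ X 0 0 - 1 ∈ I ∧ X 1 1 - 1 ∈ I}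
  mul_mem' {X Y} hX hY := by
    obtain ⟨h1, h2, h3⟩ := hX
    obtain ⟨h4, h5, h6⟩ := hY
    refine ⟨?_, ?_, ?_⟩
    · rw [mul_10]
      exact add_mem (I.mul_mem_right _ h1) (I.mul_mem_left _ h4)
    · rw [mul_00]
      convert add_mem (add_mem (I.mul_mem_left (X 0 0) h5) h2) (I.mul_mem_left (X 0 1) h4) using 1
      ring
    · rw [mul_11]
      convert add_mem (add_mem (I.mul_mem_left (X 1 1) h6) h3) (I.mul_mem_right (Y 0 1) h1) using 1
      ring
  one_mem' := by simp
  inv_mem' {X} hX := by simpa using ⟨hX.1, hX.2.2, hX.2.1⟩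

/-- Diagonal entries of triangular matrices are multiplicative, so they cancel in a commutator. As
unitriangular 2 × 2 matrices commute, the Borel subgroup is solvable of length two modulo `I`. -/
theorem commutator_borel_le (I : Ideal A) : ⁅borel I, borel I⁆ ≤ unitriangular I := by
  rw [Subgroup.commutator_le]
  intro X hX Y hY
  have hX0 : (Ideal.Quotient.mk I) (X 1 0) = 0 := Ideal.Quotient.eq_zero_iff_mem.2 hX
  have hY0 : (Ideal.Quotient.mk I) (Y 1 0) = 0 := Ideal.Quotient.eq_zero_iff_mem.2 hY
  have hX1 := congrArg (Ideal.Quotient.mk I) (det_eq X)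
  have hY1 := congrArg (Ideal.Quotient.mk I) (det_eq Y)
  simp only [map_sub, map_mul, map_one, hX0, hY0, mul_zero, sub_zero] at hX1 hY1
  refine ⟨?_, ?_, ?_⟩ <;> rw [← Ideal.Quotient.eq_zero_iff_mem] <;>
    simp only [commutatorElement_def, mul_00, mul_01, mul_10, mul_11, inv_00, inv_01, inv_10,
      inv_11, map_add, map_mul, map_sub, map_neg, map_one, hX0, hY0]
  · ring
  · linear_combination hY1 * (Ideal.Quotient.mk I (X 0 0) * Ideal.Quotient.mk I (X 1 1)) + hX1
  · linear_combination hY1 * (Ideal.Quotient.mk I (X 0 0) * Ideal.Quotient.mk I (X 1 1)) + hX1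

theorem commutator_unitriangular_le (I : Ideal A) :
    ⁅unitriangular I, unitriangular I⁆ ≤ principal I := by
  rw [Subgroup.commutator_le]
  intro X hX Y hY
  unfold principal
  rw [MonoidHom.mem_ker, map_commutatorElement, commutatorElement_eq_one_iff_mul_comm]
  have e : ∀ Z ∈ unitriangular I, Matrix.SpecialLinearGroup.map (Ideal.Quotient.mk I) Z =
      upper (Ideal.Quotient.mk I (Z 0 1)) := by
    rintro Z ⟨h1, h2, h3⟩
    have h2 := Ideal.Quotient.eq.2 h2
    have h3 := Ideal.Quotient.eq.2 h3
    apply ext <;> simp [h2, h3, Ideal.Quotient.eq_zero_iff_mem.2 h1]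
  rw [e X hX, e Y hY, ← upper_add, ← upper_add, add_comm]

end Basic

/-! ### Congruence subgroups surject onto perfect quotients -/

section Perfect

variable {A : Type*} [CommRing A] {Q : Type*} [Group Q] (π : SL(2, A) →* Q)

theorem map_commutator_eq_top {G : Type*} [Group G] {f : G →* Q} (hQ : commutator Q = ⊤)
    {H₁ H₂ : Subgroup G} (h₁ : H₁.map f = ⊤) (h₂ : H₂.map f = ⊤) : ⁅H₁, H₂⁆.map f = ⊤ := by
  rw [Subgroup.map_commutator, h₁, h₂]
  exact hQ

/-- The lower left entries of `X` and of its conjugates by `weyl` and `lower 1` together detect all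
three conditions. -/
theorem exists_mem_normal_lower_left_notMem {N : Subgroup SL(2, A)} [N.Normal] {P : Ideal A}
    {X : SL(2, A)} (hX : X ∈ N) (h : ¬ (X 0 1 ∈ P ∧ X 1 0 ∈ P ∧ X 0 0 - X 1 1 ∈ P)) :
    ∃ Y ∈ N, Y 1 0 ∉ P := by
  by_contra! hN
  have h1 := hN X hX
  have h2 := hN _ (Subgroup.Normal.conj_mem ‹_› X hX weyl)
  have h3 := hN _ (Subgroup.Normal.conj_mem ‹_› X hX (lower 1))
  simp [weyl] at h2 h3
  refine h ⟨h2, h1, ?_⟩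
  convert sub_mem h3 (sub_mem h1 h2) using 1
  ring

/-- Multiplying by conjugates of `X` does not change the image under `π`, and a suitable conjugate
by an upper unipotent brings `g` into the Borel subgroup. -/
theorem map_borel_eq_top (hπ : Function.Surjective π) {P : Ideal A} (hP : P.IsMaximal)
    {X : SL(2, A)} (hX : X ∈ π.ker) (hc : X 1 0 ∉ P) : (borel P).map π = ⊤ := by
  rw [eq_top_iff]
  rintro q -
  obtain ⟨g, rfl⟩ := hπ q
  by_cases hg : g 1 0 ∈ P
  · exact ⟨g, hg, rfl⟩
  have hcc : X 1 0 * g 1 0 ∉ P := fun h ↦ (hP.isPrime.mem_or_mem h).elim hc hg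
  obtain ⟨y, i, hi, hy⟩ := hP.exists_inv hcc
  -- This solves the linear congruence modulo `P` that kills the lower left entry of the product;
  -- `y` inverts `X 1 0 * g 1 0`.
  set t := y * (X 1 0 * g 0 0 - X 0 0 * g 1 0)
  refine ⟨(upper t * X * (upper t)⁻¹)⁻¹ * g, ?_, ?_⟩
  · change _ ∈ P
    have : ((upper t * X * (upper t)⁻¹)⁻¹ * g) 1 0 =
        (X 0 0 * g 1 0 - X 1 0 * g 0 0) * i := by
      simp [t]
      linear_combination (X 0 0 * g 1 0 - X 1 0 * g 0 0) * (-hy)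
    rw [this]
    exact P.mul_mem_left _ hi
  · have hX : π X = 1 := hX
    simp [hX]

theorem map_principal_prime_eq_top (hπ : Function.Surjective π) (hQ : commutator Q = ⊤)
    {P : Ideal A} (hP : P.IsMaximal) {X : SL(2, A)} (hX : X ∈ π.ker)
    (h : ¬ (X 0 1 ∈ P ∧ X 1 0 ∈ P ∧ X 0 0 - X 1 1 ∈ P)) : (principal P).map π = ⊤ := by
  obtain ⟨Y, hY, hc⟩ := exists_mem_normal_lower_left_notMem hX h
  have h1 := map_borel_eq_top π hπ hP hY hc
  have h2 := map_commutator_eq_top hQ h1 h1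
  have h3 := map_commutator_eq_top hQ h2 h2
  rw [eq_top_iff, ← h3]
  apply Subgroup.map_mono
  exact (Subgroup.commutator_mono (commutator_borel_le P) (commutator_borel_le P)).trans
    (commutator_unitriangular_le P)

/-- Induction on the index of `I`. If `x * y ∈ I` with neither factor in `I`, the larger ideals `I +
(x)` and `I + (y)` have product inside `I`, and commutators of their congruence subgroups still
cover `Q`. -/
theorem map_principal_eq_top (hπ : Function.Surjective π) (hQ : commutator Q = ⊤)
    (hfin : ∀ I : Ideal A, I ≠ ⊥ → Finite (A ⧸ I))
    (hP : ∀ P : Ideal A, P.IsPrime → P ≠ ⊥ → ∃ X ∈ π.ker,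
      ¬ (X 0 1 ∈ P ∧ X 1 0 ∈ P ∧ X 0 0 - X 1 1 ∈ P)) (I : Ideal A) (hI : I ≠ ⊥) :
    (principal I).map π = ⊤ := by
  induction hn : Nat.card (A ⧸ I) using Nat.strong_induction_on generalizing I with
  | _ n ih =>
  subst hn
  have := hfin I hI
  have lt : ∀ J : Ideal A, I < J → (principal J).map π = ⊤ := by
    intro J hJ
    refine ih _ ?_ J (ne_bot_of_gt hJ) rfl
    have hs : Function.Surjective (Ideal.Quotient.factor hJ.le) :=
      Ideal.Quotient.factor_surjective hJ.le
    refine lt_of_le_of_ne (Nat.card_le_card_of_surjective _ hs) fun he ↦ ?_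
    have hb := (Nat.bijective_iff_surjective_and_card _).2 ⟨hs, he.symm⟩
    obtain ⟨x, hx, hxI⟩ := Set.exists_of_ssubset hJ
    apply hxI
    refine Ideal.Quotient.eq_zero_iff_mem.1 (hb.1 ?_)
    rw [map_zero, Ideal.Quotient.factor_mk, Ideal.Quotient.eq_zero_iff_mem]
    exact hx
  by_cases htop : I = ⊤
  · subst htop
    have : principal (⊤ : Ideal A) = ⊤ := by
      ext; simp [mem_principal]
    rw [this, ← MonoidHom.range_eq_map, MonoidHom.range_eq_top.2 hπ]
  by_cases hp : I.IsPrime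
  · obtain ⟨X, hX, h⟩ := hP I hp hI
    have := Ideal.Quotient.isDomain I
    have hm : I.IsMaximal := Ideal.Quotient.maximal_of_isField _ (Finite.isField_of_domain _)
    exact map_principal_prime_eq_top π hπ hQ hm hX h
  · obtain ⟨x, hx, y, hy, hxy⟩ : ∃ x, x ∉ I ∧ ∃ y, y ∉ I ∧ x * y ∈ I := by
      by_contra! hcon
      exact hp ⟨htop, fun {x y} hxy ↦ by
        by_contra! h
        exact hcon x h.1 y h.2 hxy⟩
    have hlt : ∀ z, z ∉ I → I < I ⊔ Ideal.span {z} := fun z hz ↦ by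
      refine lt_of_le_of_ne le_sup_left fun he ↦ hz ?_
      rw [he]
      exact Ideal.mem_sup_right (Ideal.mem_span_singleton_self z)
    have h := map_commutator_eq_top hQ (lt _ (hlt x hx)) (lt _ (hlt y hy))
    rw [eq_top_iff, ← h]
    apply Subgroup.map_mono
    refine (commutator_principal_le _ _).trans (principal_mono ?_)
    rw [Ideal.sup_mul, Ideal.mul_sup, Ideal.mul_sup, Ideal.span_singleton_mul_span_singleton]
    refine sup_le (sup_le Ideal.mul_le_right Ideal.mul_le_left) (sup_le Ideal.mul_le_right ?_)
    rwa [Ideal.span_singleton_le_iff_mem]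

end Perfect

end SL2

/-! ### Moving a coprime pair to a rational prime -/

namespace NumberRing

open Polynomial IntermediateField Module

section Congruence

theorem exists_modEq_of_primes (s : Finset ℕ) (hs : ∀ l ∈ s, l.Prime) (k : ℕ) (x : ℕ → ℕ) :
    ∃ t : ℕ, ∀ l ∈ s, t ≡ x l [MOD l ^ k] := by
  obtain ⟨t, ht⟩ := Nat.chineseRemainderOfFinset x (fun l ↦ l ^ k) s
    (fun l hl ↦ pow_ne_zero _ (hs l hl).ne_zero)
    (fun l hl l' hl' hne ↦ Nat.Coprime.pow _ _
      ((Nat.coprime_primes (hs l hl) (hs l' hl')).2 hne))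
  exact ⟨t, ht⟩

/-- Modulo `l` the polynomial is nonzero of degree below `l`, so it cannot vanish on all of `𝔽_l`,
and `-Q t` runs through all residues. -/
theorem exists_not_dvd_eval (f : ℤ[X]) (hf : f.IsPrimitive) {l : ℕ} (hl : l.Prime)
    (hdeg : f.natDegree < l) {Q : ℕ} (hlQ : ¬ l ∣ Q) :
    ∃ t : ℕ, ¬ (l : ℤ) ∣ f.eval (-(Q : ℤ) * t) := by
  have := Fact.mk hl
  by_contra! h
  set g := f.map (Int.castRingHom (ZMod l)) with hg
  have hg0 : g ≠ 0 := by
    intro h0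
    have hd : C (l : ℤ) ∣ f := by
      rw [C_dvd_iff_dvd_coeff]
      intro i
      have := congrArg (fun p ↦ p.coeff i) h0
      rw [← ZMod.intCast_zmod_eq_zero_iff_dvd]
      simpa [g] using this
    have := hf _ hd
    rw [Int.isUnit_iff] at this
    have := hl.two_le
    omega
  have hQ : (Q : ZMod l) ≠ 0 := by
    rwa [Ne, ZMod.natCast_eq_zero_iff]
  have hroot : ∀ x : ZMod l, g.eval x = 0 := by
    intro x
    have hx := h (-(x / Q)).val
    rw [← ZMod.intCast_zmod_eq_zero_iff_dvd, ← eq_intCast (Int.castRingHom (ZMod l)),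
      ← eval_map_apply] at hx
    rw [← hx, hg]
    congr 1
    simp
    field_simp
  have hcard : l ≤ g.natDegree := by
    have := card_le_degree_of_subset_roots (p := g) (Z := Finset.univ) (by
      intro x _
      rw [mem_roots hg0]
      exact hroot x)
    simpa [ZMod.card] using this
  have : g.natDegree ≤ f.natDegree := natDegree_map_le
  omega

end Congruence

section Contraction

variable {R : Type*} [CommRing R]

theorem exists_nat_dvd_intCast_iff (b : R) : ∃ m : ℕ, ∀ i : ℤ, b ∣ (i : R) ↔ (m : ℤ) ∣ i := by
  obtain ⟨g, hg⟩ := (IsPrincipalIdealRing.principal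
    ((Ideal.span {b}).comap (Int.castRingHom R))).principal
  refine ⟨g.natAbs, fun i ↦ ?_⟩
  have : i ∈ (Ideal.span {b}).comap (Int.castRingHom R) ↔ i ∈ Ideal.span {g} := by
    rw [hg, Ideal.submodule_span_eq]
  rw [Ideal.mem_comap, Ideal.mem_span_singleton, Ideal.mem_span_singleton] at this
  rw [Int.natAbs_dvd, ← this, eq_intCast]

/-- Here `m` generates `(b) ∩ ℤ`. If `g = gcd(i, m)` and `m = g m'`, then `b` is coprime to `g` and
so divides `m'`; minimality of `m` forces `g = 1`. -/
theorem isCoprime_of_dvd_intCast_iff {b : R} {m : ℕ} (hm : m ≠ 0)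
    (h : ∀ i : ℤ, b ∣ (i : R) ↔ (m : ℤ) ∣ i) {i : ℤ} (hi : IsCoprime (i : R) b) :
    IsCoprime i (m : ℤ) := by
  rw [Int.isCoprime_iff_gcd_eq_one]
  obtain ⟨i', hi'⟩ : (i.gcd m : ℤ) ∣ i := Int.gcd_dvd_left ..
  obtain ⟨m', hm'⟩ : (i.gcd m : ℤ) ∣ m := Int.gcd_dvd_right ..
  set g := i.gcd m
  have hg : IsCoprime b ((g : ℤ) : R) := by
    rw [hi', Int.cast_mul] at hi
    exact hi.of_mul_left_left.symm
  have h1 : b ∣ ((m : ℤ) : R) := (h m).2 dvd_rfl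
  rw [hm', Int.cast_mul] at h1
  have h2 := (h _).1 (hg.dvd_of_dvd_mul_left h1)
  have hm'0 : m' ≠ 0 := by
    rintro rfl
    simp at hm'
    exact hm hm'
  rw [hm'] at h2
  have h3 : (g : ℤ) ∣ 1 := by
    rw [← mul_dvd_mul_iff_right hm'0, one_mul]
    exact h2
  exact_mod_cast Int.eq_one_of_dvd_one (by positivity) h3

theorem isCoprime_intCast_of_prime_factors {b : R} {D : ℕ} (hD : D ≠ 0)
    (h : ∀ l : ℕ, l.Prime → l ∣ D → IsCoprime (l : R) b) : IsCoprime (D : R) b := by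
  induction D using Nat.recOnMul with
  | zero => exact absurd rfl hD
  | one => simpa using isCoprime_one_left
  | prime p hp => exact h p hp dvd_rfl
  | mul x y hx hy =>
    rw [Nat.cast_mul]
    have := mul_ne_zero_iff.1 hD
    exact (hx this.1 fun l hl hd ↦ h l hl (hd.mul_right _)).mul_left
      (hy this.2 fun l hl hd ↦ h l hl (hd.mul_left _))

end Contraction

section Fraction

variable {R : Type*} [CommRing R] [IsDomain R] (K : Type*) [Field K] [NumberField K] [Algebra R K]
  [IsFractionRing R K]

include K in
omit [IsDomain R] [IsFractionRing R K] in
theorem charZero : CharZero R :=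
  ⟨fun m n h ↦ by
    have := congrArg (algebraMap R K) h
    rw [map_natCast, map_natCast] at this
    exact_mod_cast this⟩

include K in
omit [IsDomain R] in
theorem isAlgebraic_int (x : R) : IsAlgebraic ℤ x := by
  have : IsAlgebraic ℤ (algebraMap R K x) :=
    (IsFractionRing.isAlgebraic_iff ℤ ℚ K).2 (Algebra.IsAlgebraic.isAlgebraic _)
  exact (isAlgebraic_algebraMap_iff (IsFractionRing.injective R K)).1 this

include K in
theorem exists_dvd_natCast {x : R} (hx : x ≠ 0) : ∃ m : ℕ, m ≠ 0 ∧ x ∣ (m : R) := by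
  obtain ⟨r, hr, hd⟩ := (isAlgebraic_int K x).exists_nonzero_dvd (mem_nonZeroDivisors_of_ne_zero hx)
  refine ⟨r.natAbs, by simpa using hr, ?_⟩
  rw [eq_intCast] at hd
  have : ((r.natAbs : ℤ) : R) = r ∨ ((r.natAbs : ℤ) : R) = -r := by
    rcases Int.natAbs_eq r with h | h
    · left; rw [← h]
    · right; rw [← Int.cast_neg]; congr 1; omega
  rw [Int.cast_natCast] at this
  rcases this with h | h <;> rw [h]
  · exact hd
  · exact hd.neg_right

/-- Scale a primitive element into `R`. Among the translates of `α` by its multiples, two generate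
the same field because there are finitely many subfields; their difference recovers the primitive
element. -/
theorem exists_adjoin_add_eq_top (α : K) {q : ℕ} (hq : q ≠ 0) :
    ∃ c : R, ℚ⟮α + q * algebraMap R K c⟯ = ⊤ := by
  obtain ⟨γ, hγ⟩ := Field.exists_primitive_element ℚ K
  obtain ⟨x, y, hy, rfl⟩ := IsFractionRing.div_surjective (A := R) γ
  obtain ⟨m, hm, w, hw⟩ := exists_dvd_natCast K (nonZeroDivisors.ne_zero hy)
  have hy0 : algebraMap R K y ≠ 0 := by
    simpa using nonZeroDivisors.ne_zero hy
  have hη : algebraMap R K (x * w) = m * (algebraMap R K x / algebraMap R K y) := by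
    have : (m : K) = algebraMap R K y * algebraMap R K w := by
      rw [← map_mul, ← hw, map_natCast]
    rw [this, map_mul]
    field_simp
  have hfin : Finite (IntermediateField ℚ K) :=
    (Field.exists_primitive_element_iff_finite_intermediateField ℚ K).1 ⟨inferInstance, _, hγ⟩
  obtain ⟨z, z', hne, he⟩ := Finite.exists_ne_map_eq_of_infinite
    (fun z : ℕ ↦ ℚ⟮α + q * algebraMap R K ((z : R) * (x * w))⟯)
  refine ⟨z * (x * w), ?_⟩
  set F := ℚ⟮α + q * algebraMap R K ((z : R) * (x * w))⟯
  have h1 : α + q * algebraMap R K ((z : R) * (x * w)) ∈ F := mem_adjoin_simple_self ℚ _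
  have h2 : α + q * algebraMap R K ((z' : R) * (x * w)) ∈ F := by
    rw [show F = _ from he]; exact mem_adjoin_simple_self ℚ _
  have h3 := F.sub_mem h1 h2
  have h4 : ((q * ((z : ℚ) - z') * m : ℚ) : K) * (algebraMap R K x / algebraMap R K y) ∈ F := by
    convert h3 using 1
    rw [map_mul _ (z : R), map_mul _ (z' : R), hη]
    simp
    ring
  have hne' : (q * ((z : ℚ) - z') * m : ℚ) ≠ 0 := by
    have : (z : ℚ) - z' ≠ 0 := sub_ne_zero.2 (by exact_mod_cast hne)
    positivity
  have h5 : algebraMap R K x / algebraMap R K y ∈ F := by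
    have := F.mul_mem (F.inv_mem (SubfieldClass.ratCast_mem F (q * ((z : ℚ) - z') * m : ℚ))) h4
    rwa [inv_mul_cancel_left₀ (by exact_mod_cast hne')] at this
  rw [eq_top_iff, ← hγ]
  exact adjoin_simple_le_iff.2 h5

/-- An algebraic number is a root of a primitive integral polynomial of bounded degree. -/
theorem exists_isPrimitive_aeval_eq_zero (θ : K) :
    ∃ f : ℤ[X], f.IsPrimitive ∧ f.natDegree ≤ finrank ℚ K ∧ aeval θ f = 0 := by
  have hint : IsIntegral ℚ θ := Algebra.IsIntegral.isIntegral θ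
  set g := IsLocalization.integerNormalization (nonZeroDivisors ℤ) (minpoly ℚ θ)
  have hg0 : g ≠ 0 := by
    rw [Ne, IsLocalization.integerNormalization_eq_zero_iff le_rfl]
    exact minpoly.ne_zero hint
  refine ⟨g.primPart, g.isPrimitive_primPart, ?_, ?_⟩
  · rw [natDegree_primPart]
    refine le_trans ?_ (minpoly.natDegree_le θ)
    exact natDegree_le_of_degree_le
      ((Finset.sup_mono (IsLocalization.integerNormalization_support _ _)).trans degree_le_natDegree)
  · exact aeval_primPart_eq_zero hg0
      (IsLocalization.integerNormalization_aeval_eq_zero _ _ (minpoly.aeval ℚ θ))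

theorem exists_natCast_mul_eq_aeval {θ : K} (hθ : ℚ⟮θ⟯ = ⊤) (a : K) :
    ∃ (G : ℤ[X]) (D : ℕ), D ≠ 0 ∧ (D : K) * a = aeval θ G := by
  have h : a ∈ ℚ⟮θ⟯.toSubalgebra := by rw [hθ]; trivial
  rw [adjoin_simple_toSubalgebra_of_isAlgebraic (Algebra.IsAlgebraic.isAlgebraic θ),
    Algebra.adjoin_singleton_eq_range_aeval] at h
  obtain ⟨g, hg⟩ := h
  obtain ⟨D, hD, hG⟩ := IsLocalization.integerNormalization_spec (nonZeroDivisors ℤ) g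
  set G := IsLocalization.integerNormalization (nonZeroDivisors ℤ) g
  have key : aeval θ G = (D : K) * a := by
    rw [← aeval_map_algebraMap ℚ, hG, map_zsmul, zsmul_eq_mul]
    congr 1
  have hD := nonZeroDivisors.ne_zero hD
  rcases Int.natAbs_eq D with h | h
  · refine ⟨G, D.natAbs, by simpa using hD, ?_⟩
    rw [key, ← Int.cast_natCast, ← h]
  · refine ⟨-G, D.natAbs, by simpa using hD, ?_⟩
    rw [map_neg, key, ← neg_mul, ← Int.cast_natCast, ← Int.cast_neg]
    congr 2
    omega

variable {K} in
omit [IsDomain R] in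
/-- Modulo `b + a y`, the quotient `b / a` behaves as `-y` in homogenized polynomials. -/
theorem dvd_scaleRoots_eval_sub (f : ℤ[X]) (a b : R) (y : ℤ) (ha : a ≠ 0) :
    ∃ F : R, algebraMap R K F =
        algebraMap R K a ^ f.natDegree * aeval (algebraMap R K b / algebraMap R K a) f ∧
      b + a * y ∣ F - a ^ f.natDegree * (f.eval (-y) : ℤ) := by
  have := charZero (R := R) K
  set g := f.map (Int.castRingHom R)
  have hdeg : g.natDegree = f.natDegree := natDegree_map_eq_of_injective Int.cast_injective f
  have ha' : algebraMap R K a ≠ 0 := by simpa using ha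
  refine ⟨(scaleRoots g a).eval b, ?_, ?_⟩
  · have h := scaleRoots_eval₂_mul (p := g) (algebraMap R K) (algebraMap R K b / algebraMap R K a) a
    rw [mul_div_cancel₀ _ ha'] at h
    rw [← eval₂_at_apply, h, hdeg, eval₂_map, aeval_def]
    congr 2
    exact RingHom.ext_int _ _
  · have h := sub_dvd_eval_sub b (a * (-y : ℤ)) (scaleRoots g a)
    rw [scaleRoots_eval_mul, hdeg] at h
    have e : g.eval ((-y : ℤ) : R) = ((f.eval (-y) : ℤ) : R) := by
      simp only [g]
      rw [← eq_intCast (Int.castRingHom R), eval_map_apply, eq_intCast]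
    rw [e] at h
    convert h using 1
    push_cast
    ring

include K in
/-- The key arithmetic fact: a coprime pair `(a, b)` can be moved, by elementary operations
of level `Q`, to a pair whose first entry is a rational prime in a prescribed residue class. -/
theorem exists_prime_eq_add {Q : ℕ} (hQ : Q ≠ 0) (hn : (finrank ℚ K).factorial ∣ Q) {ρ : ℤ}
    (hρ : IsCoprime ρ (Q : ℤ)) {a b : R} (hab : IsCoprime a b) (ha : (Q : R) ^ 2 ∣ a - ρ) (B : ℕ) :
    ∃ (τ τ' : R) (r : ℕ), r.Prime ∧ B < r ∧ (r : ℤ) ≡ ρ [ZMOD (Q ^ 2 : ℕ)] ∧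
      (r : R) = a + Q ^ 2 * (b + a * τ) * τ' := by
  have := charZero (R := R) K
  have hQR : (Q : R) ≠ 0 := by exact_mod_cast hQ
  obtain ⟨ρ', κ, hρ'⟩ := id hρ
  have hρR : (ρ' : R) * ρ + κ * Q = 1 := by exact_mod_cast congrArg (Int.cast : ℤ → R) hρ'
  obtain ⟨ε, hε⟩ := ha
  by_cases ha0 : a = 0
  · -- `Q` is then a unit
    subst ha0
    obtain ⟨u, v, huv⟩ := hab
    simp only [mul_zero, zero_add] at huv
    obtain ⟨r, hrB, hr, hmod⟩ := Nat.forall_exists_prime_gt_and_zmodEq B (q := Q ^ 2) (a := ρ)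
      (by positivity) (by push_cast; exact hρ.pow_right)
    have hu : IsUnit (Q : R) := by
      refine IsUnit.of_mul_eq_one (κ - ρ' * Q * ε) ?_
      linear_combination hρR + ρ' * hε
    obtain ⟨w, hw⟩ := hu.exists_right_inv
    refine ⟨0, v * w ^ 2 * r, r, hr, hrB, hmod, ?_⟩
    linear_combination (-(r : R)) * huv - b * v * r * (Q * w + 1) * hw
  have haK : algebraMap R K a ≠ 0 := by simpa using ha0
  obtain ⟨c, hc⟩ := exists_adjoin_add_eq_top K (R := R)
    (algebraMap R K (b + a * ((1 - b) * ρ')) / algebraMap R K a) hQ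
  -- The term `(1 - b) * ρ'` makes `b₂ ≡ 1` modulo `Q`, since `a ρ' ≡ 1`. The term `Q * c` preserves
  -- this and makes `b₂ / a` generate `K`.
  set b₂ := b + a * ((1 - b) * ρ' + Q * c) with hb₂
  have hθ : algebraMap R K (b + a * ((1 - b) * ρ')) / algebraMap R K a + Q * algebraMap R K c =
      algebraMap R K b₂ / algebraMap R K a := by
    rw [eq_div_iff haK, add_mul, div_mul_cancel₀ _ haK, hb₂]
    simp only [map_add, map_mul, map_natCast]
    ring
  rw [hθ] at hc
  obtain ⟨f, hf, hfdeg, hf0⟩ := exists_isPrimitive_aeval_eq_zero K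
    (algebraMap R K b₂ / algebraMap R K a)
  obtain ⟨G, D, hD, hG⟩ := exists_natCast_mul_eq_aeval K hc (algebraMap R K a)
  -- An auxiliary prime not dividing `Q`: nondivisibility by `l₀` will ensure `e ≠ 0`.
  obtain ⟨l₀, hl₀, hl₀p⟩ := Nat.exists_infinite_primes (Q + 1)
  have hl₀Q : ¬ l₀ ∣ Q := fun h ↦ by
    have := Nat.le_of_dvd (Nat.pos_of_ne_zero hQ) h
    omega
  have hex : ∀ l : ℕ, ∃ t : ℕ, l.Prime → ¬ l ∣ Q → ¬ (l : ℤ) ∣ f.eval (-(Q : ℤ) * t) := by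
    intro l
    by_cases h : l.Prime ∧ ¬ l ∣ Q
    · obtain ⟨t, ht⟩ := exists_not_dvd_eval f hf h.1 (by
        by_contra! hle
        exact h.2 (((Nat.Prime.dvd_factorial h.1).2 (hle.trans hfdeg)).trans hn)) h.2
      exact ⟨t, fun _ _ ↦ ht⟩
    · exact ⟨0, fun h1 h2 ↦ absurd ⟨h1, h2⟩ h⟩
  choose x hx using hex
  obtain ⟨t, ht⟩ := exists_modEq_of_primes (D * l₀).primeFactors
    (fun l hl ↦ Nat.prime_of_mem_primeFactors hl) 1 x
  have hDl : D * l₀ ≠ 0 := mul_ne_zero hD hl₀p.ne_zero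
  have hnd : ∀ l : ℕ, l.Prime → l ∣ D * l₀ → ¬ l ∣ Q → ¬ (l : ℤ) ∣ f.eval (-((Q : ℤ) * t)) := by
    intro l hl hlD hlQ hdvd
    refine hx l hl hlQ ?_
    have h1 := ht l (Nat.mem_primeFactors.2 ⟨hl, hlD, hDl⟩)
    rw [pow_one] at h1
    have h2 : (l : ℤ) ∣ -(Q : ℤ) * x l - (-((Q : ℤ) * t)) := by
      have h3 : (l : ℤ) ∣ t - x l := (Int.natCast_modEq_iff.2 h1).symm.dvd
      have h4 : -(Q : ℤ) * x l - (-((Q : ℤ) * t)) = Q * (t - x l) := by ring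
      rw [h4]
      exact h3.mul_left _
    have h3 := h2.trans (sub_dvd_eval_sub _ _ f)
    exact (dvd_sub_left hdvd).1 h3
  set e : ℤ := f.eval (-((Q : ℤ) * t)) with he
  have he0 : e ≠ 0 := fun h ↦
    hnd l₀ hl₀p (dvd_mul_left _ _) hl₀Q (by rw [h]; exact dvd_zero _)
  set b₁ := b₂ + a * ((Q * t : ℤ) : R) with hb₁
  have hab₁ : IsCoprime a b₁ := by
    have : b₁ = b + a * ((1 - b) * ρ' + Q * c + ((Q * t : ℤ) : R)) := by
      rw [hb₁, hb₂]; ring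
    rw [this]
    exact IsCoprime.add_mul_left_right hab _
  have hQb₁ : IsCoprime (Q : R) b₁ := by
    refine ⟨-(a * (c + t) + (1 - b) * (ρ' * Q * ε - κ)), 1, ?_⟩
    rw [hb₁, hb₂]
    push_cast
    linear_combination (1 - b) * ρ' * hε + (1 - b) * hρR
  obtain ⟨F₁, hF₁, hF₁d⟩ := dvd_scaleRoots_eval_sub (K := K) f a b₂ (Q * t) ha0
  obtain ⟨F₂, hF₂, hF₂d⟩ := dvd_scaleRoots_eval_sub (K := K) G a b₂ (Q * t) ha0
  have hb₁e : b₁ ∣ (e : R) := by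
    rw [hf0, mul_zero] at hF₁
    have : F₁ = 0 := by simpa using hF₁
    rw [this, zero_sub, dvd_neg] at hF₁d
    exact (hab₁.symm.pow_right).dvd_of_dvd_mul_left hF₁d
  set z : ℤ := G.eval (-((Q : ℤ) * t))
  -- Modulo `b₁` the quotient `b₂ / a` is the integer `-Q t`, so `D a`, a polynomial in it, is
  -- congruent to an integer. Once `D` is inverted modulo `m`, so is `a`.
  have hb₁z : b₁ ∣ D * a - z := by
    rw [← hG, ← map_natCast (algebraMap R K) D, ← map_pow, ← map_mul, ← map_mul] at hF₂
    rw [IsFractionRing.injective R K hF₂, ← mul_sub] at hF₂d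
    exact (hab₁.symm.pow_right).dvd_of_dvd_mul_left hF₂d
  have hDb₁ : IsCoprime (D : R) b₁ := by
    refine isCoprime_intCast_of_prime_factors hD fun l hl hlD ↦ ?_
    by_cases hlQ : l ∣ Q
    · exact hQb₁.of_isCoprime_of_dvd_left (Nat.cast_dvd_cast hlQ)
    · have h1 : IsCoprime (l : ℤ) e :=
        (Nat.prime_iff_prime_int.1 hl).coprime_iff_not_dvd.2 (hnd l hl (hlD.mul_right _) hlQ)
      have h2 : IsCoprime ((l : ℤ) : R) (e : R) := by simpa using h1.map (Int.castRingHom R)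
      rw [Int.cast_natCast] at h2
      exact h2.of_isCoprime_of_dvd_right hb₁e
  obtain ⟨m, hm⟩ := exists_nat_dvd_intCast_iff b₁
  have hm0 : m ≠ 0 := by
    rintro rfl
    exact he0 (by simpa using (hm e).1 hb₁e)
  have hb₁m : b₁ ∣ (m : R) := by simpa using (hm m).2 dvd_rfl
  have hDm : IsCoprime (D : ℤ) (m : ℤ) := isCoprime_of_dvd_intCast_iff hm0 hm (by simpa using hDb₁)
  have hQm : IsCoprime (Q : ℤ) (m : ℤ) := isCoprime_of_dvd_intCast_iff hm0 hm (by simpa using hQb₁)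
  obtain ⟨α, β, hαβ⟩ := hDm
  have hαβR : (α : R) * D + β * m = 1 := by exact_mod_cast congrArg (Int.cast : ℤ → R) hαβ
  have haz : b₁ ∣ a - (α * z : ℤ) := by
    have : a - (α * z : ℤ) = α * (D * a - z) + m * (a * β) := by
      push_cast
      linear_combination (-a) * hαβR
    rw [this]
    exact dvd_add (hb₁z.mul_left _) (hb₁m.mul_right _)
  have hzm : IsCoprime (α * z) (m : ℤ) := by
    refine isCoprime_of_dvd_intCast_iff hm0 hm ?_
    obtain ⟨y, hy⟩ := haz
    have : ((α * z : ℤ) : R) = a + b₁ * (-y) := by linear_combination -hy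
    rw [this]
    exact IsCoprime.add_mul_left_left hab₁ _
  -- Dirichlet will be applied to the class that is `α z` modulo `m` and `ρ` modulo `Q ^ 2`. Then `r
  -- - a` is divisible by the coprime elements `b₁` and `Q ^ 2`.
  obtain ⟨s, s', hss⟩ : IsCoprime (m : ℤ) ((Q : ℤ) ^ 2) := hQm.symm.pow_right
  have hr₀ : IsCoprime (α * z * s' * Q ^ 2 + ρ * s * m) ((m * Q ^ 2 : ℕ) : ℤ) := by
    push_cast
    refine IsCoprime.mul_right ?_ ?_
    · have : α * z * s' * Q ^ 2 + ρ * s * m = α * z + m * (s * (ρ - α * z)) := by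
        linear_combination (α * z) * hss
      rw [this]
      exact IsCoprime.add_mul_left_left hzm _
    · have : α * z * s' * Q ^ 2 + ρ * s * m = ρ + (Q : ℤ) ^ 2 * (s' * (α * z - ρ)) := by
        linear_combination ρ * hss
      rw [this]
      exact IsCoprime.add_mul_left_left hρ.pow_right _
  obtain ⟨r, hrB, hr, hmod⟩ := Nat.forall_exists_prime_gt_and_zmodEq B (by positivity) hr₀
  obtain ⟨k, hk⟩ := hmod.symm.dvd
  push_cast at hk
  have hrQ : (r : ℤ) - ρ = Q ^ 2 * (s' * (α * z - ρ) + m * k) := by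
    linear_combination hk + ρ * hss
  have hrm : (r : ℤ) - α * z = m * (s * (ρ - α * z) + Q ^ 2 * k) := by
    linear_combination hk + (α * z) * hss
  have hd1 : b₁ ∣ (r : R) - a := by
    have h1 : (r : R) - (α * z : ℤ) = m * (s * (ρ - α * z) + Q ^ 2 * k : ℤ) := by
      exact_mod_cast congrArg (Int.cast : ℤ → R) hrm
    have h2 : (r : R) - a = m * (s * (ρ - α * z) + Q ^ 2 * k : ℤ) - (a - (α * z : ℤ)) := by
      linear_combination h1
    rw [h2]
    exact dvd_sub (hb₁m.mul_right _) haz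
  have hd2 : (Q : R) ^ 2 ∣ (r : R) - a := by
    have h1 : (r : R) - ρ = Q ^ 2 * (s' * (α * z - ρ) + m * k : ℤ) := by
      exact_mod_cast congrArg (Int.cast : ℤ → R) hrQ
    refine ⟨(s' * (α * z - ρ) + m * k : ℤ) - ε, ?_⟩
    linear_combination h1 - hε
  obtain ⟨τ', hτ'⟩ := (hQb₁.pow_left (m := 2)).mul_dvd hd2 hd1
  refine ⟨(1 - b) * ρ' + Q * c + ((Q * t : ℤ) : R), τ', r, hr, hrB, ?_, ?_⟩
  · refine (Int.modEq_of_dvd ?_).symm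
    exact ⟨s' * (α * z - ρ) + m * k, by push_cast; exact hrQ⟩
  · have : b + a * ((1 - b) * ρ' + Q * c + ((Q * t : ℤ) : R)) = b₁ := by
      rw [hb₁, hb₂]; ring
    rw [this, ← hτ']
    ring

end Fraction

end NumberRing

namespace NumberRing

open Module

/-! ### Primes `r` for which `|GL_d(𝔽_r)|` has small common divisors with a given number -/

section Residues

theorem le_mul_of_pow_dvd_prod {l : ℕ} (hl : l.Prime) {c k d : ℕ} (x : Fin d → ℕ)
    (hx : ∀ i, ¬ l ^ c ∣ x i) (h : l ^ k ∣ ∏ i, x i) : k ≤ c * d := by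
  have h0 : ∀ i, x i ≠ 0 := fun i h0 ↦ hx i (h0 ▸ dvd_zero _)
  rw [hl.pow_dvd_iff_le_factorization (Finset.prod_ne_zero_iff.2 fun i _ ↦ h0 i),
    Nat.factorization_prod (fun i _ ↦ h0 i), Finset.sum_apply'] at h
  refine h.trans ((Finset.sum_le_card_nsmul _ _ c fun i _ ↦ ?_).trans (by simp [mul_comm]))
  by_contra! hlt
  exact hx i ((hl.pow_dvd_iff_le_factorization (h0 i)).2 hlt.le)

/-- For large `l` a primitive root works, having order `l - 1 > n`. For small `l` take `l + 1`,
whose powers up to `n` stay strictly between `1` and `l ^ (2 * n)`. -/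
theorem exists_pow_not_modEq_one {n : ℕ} (hn : n ≠ 0) {l : ℕ} (hl : l.Prime) :
    ∃ x : ℕ, ¬ l ∣ x ∧ (n + 1 < l → ∀ f ∈ Finset.Icc 1 n, ¬ x ^ f ≡ 1 [MOD l]) ∧
      ∀ f ∈ Finset.Icc 1 n, l ≤ n + 1 → ¬ x ^ f ≡ 1 [MOD l ^ (2 * n)] := by
  have := Fact.mk hl
  by_cases h : n + 1 < l
  · obtain ⟨g, hg⟩ := IsCyclic.exists_ofOrder_eq_natCard (α := (ZMod l)ˣ)
    rw [Nat.card_eq_fintype_card, ZMod.card_units] at hg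
    have hval : (((g : ZMod l).val : ℕ) : ZMod l) = g := ZMod.natCast_zmod_val _
    refine ⟨(g : ZMod l).val, ?_, fun _ f hf hmod ↦ ?_, fun _ _ h' ↦ absurd h h'.not_gt⟩
    · rw [← ZMod.natCast_eq_zero_iff, hval]
      exact g.ne_zero
    · rw [← ZMod.natCast_eq_natCast_iff, Nat.cast_pow, hval, Nat.cast_one] at hmod
      have h1 : g ^ f = 1 := by ext; simpa using hmod
      have h2 := orderOf_dvd_of_pow_eq_one h1
      rw [Finset.mem_Icc] at hf
      have := Nat.le_of_dvd (by omega) h2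
      omega
  · refine ⟨l + 1, ?_, fun h' ↦ absurd h' h, fun f hf _ hmod ↦ ?_⟩
    · intro hd
      exact hl.one_lt.ne' (Nat.dvd_one.1 ((Nat.dvd_add_right dvd_rfl).1 hd))
    · rw [Finset.mem_Icc] at hf
      have h2 := hl.two_le
      have hle : (l + 1) ^ f < l ^ (2 * n) := by
        calc (l + 1) ^ f ≤ (l + 1) ^ n := Nat.pow_le_pow_right (by omega) hf.2
          _ < (l ^ 2) ^ n := Nat.pow_lt_pow_left (by nlinarith) hn
          _ = l ^ (2 * n) := by rw [pow_mul]
      have h1 : 1 < (l + 1) ^ f := Nat.one_lt_pow (by omega) (by omega)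
      exact h1.ne' (Nat.ModEq.eq_of_lt_of_lt hmod hle (h1.trans hle))

/-- There is a residue class such that, for the primes `r` in it, the order of `GL_d(𝔽_r)` has
a bounded common divisor with any divisor of `W`, up to powers of `p`. -/
theorem exists_residue {n : ℕ} (hn : n ≠ 0) {W : ℕ} (hW : W ≠ 0) {p : ℕ} (hp : p.Prime)
    (hpW : p ∣ W) : ∃ ρ : ℕ, ρ.Coprime W ∧ ρ ≡ 1 [MOD p] ∧ ∀ r : ℕ, r.Prime →
      (∀ l, l.Prime → l ∣ W → r ≡ ρ [MOD l ^ (2 * n)]) → ∀ d ≤ n, ∀ w, w ≠ 0 → w ∣ W →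
      (∏ i : Fin d, (r ^ d - r ^ (i : ℕ))).gcd w ∣ (n + 1).factorial ^ (2 * n * n) * p ^ w := by
  -- Primes `l > n + 1` other than `p` will not divide the order at all; the other `l ≤ n + 1`
  -- divide each of its at most `n` factors to a power below `2 * n`. At `p` the class is `1`,
  -- giving no control, and `p ^ w` absorbs the loss.
  have hex : ∀ l : ℕ, ∃ x : ℕ, l.Prime → ¬ l ∣ x ∧ (l = p → x = 1) ∧ (l ≠ p →
      (n + 1 < l → ∀ f ∈ Finset.Icc 1 n, ¬ x ^ f ≡ 1 [MOD l]) ∧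
      ∀ f ∈ Finset.Icc 1 n, l ≤ n + 1 → ¬ x ^ f ≡ 1 [MOD l ^ (2 * n)]) := by
    intro l
    by_cases hl : l.Prime
    · by_cases hlp : l = p
      · exact ⟨1, fun _ ↦ ⟨by simpa using hl.one_lt.ne', fun _ ↦ rfl, fun h ↦ absurd hlp h⟩⟩
      · obtain ⟨x, hx⟩ := exists_pow_not_modEq_one hn hl
        exact ⟨x, fun _ ↦ ⟨hx.1, fun h ↦ absurd h hlp, fun _ ↦ hx.2⟩⟩
    · exact ⟨0, fun h ↦ absurd h hl⟩
  choose x hx using hex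
  obtain ⟨ρ, hρ⟩ := exists_modEq_of_primes W.primeFactors
    (fun l hl ↦ Nat.prime_of_mem_primeFactors hl) (2 * n) x
  have hdl : ∀ l : ℕ, l ∣ l ^ (2 * n) := fun l ↦ dvd_pow_self l (by omega)
  have hρl : ∀ l : ℕ, l.Prime → l ∣ W → ¬ l ∣ ρ := by
    intro l hl hlW hd
    refine (hx l hl).1 ?_
    exact (((hρ l (Nat.mem_primeFactors.2 ⟨hl, hlW, hW⟩)).of_dvd (hdl l)).dvd_iff dvd_rfl).1 hd
  refine ⟨ρ, ?_, ?_, ?_⟩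
  · exact Nat.coprime_of_dvd fun l hl hd hd' ↦ hρl l hl hd' hd
  · have h := (hρ p (Nat.mem_primeFactors.2 ⟨hp, hpW, hW⟩)).of_dvd (hdl p)
    rwa [(hx p hp).2.1 rfl] at h
  · intro r hr hmod d hd w hw hwW
    rw [Nat.dvd_iff_prime_pow_dvd_dvd]
    intro l k hl hk
    obtain ⟨hk1, hk2⟩ := Nat.dvd_gcd_iff.1 hk
    by_cases hlp : l = p
    · subst hlp
      refine ((pow_dvd_pow l ?_).mul_left _)
      exact (Nat.lt_pow_self hl.one_lt).le.trans (Nat.le_of_dvd (Nat.pos_of_ne_zero hw) hk2)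
    rcases Nat.eq_zero_or_pos k with rfl | hkpos
    · simp
    have hlW : l ∣ W := (dvd_pow_self l hkpos.ne').trans (hk2.trans hwW)
    have hrx : r ≡ x l [MOD l ^ (2 * n)] :=
      (hmod l hl hlW).trans (hρ l (Nat.mem_primeFactors.2 ⟨hl, hlW, hW⟩))
    have hlr : ¬ l ∣ r := fun h ↦ (hx l hl).1 ((((hrx.of_dvd (hdl l)).dvd_iff dvd_rfl)).1 h)
    have hfactor : ∀ (i : Fin d) (c : ℕ), l ^ c ∣ r ^ d - r ^ (i : ℕ) →
        r ^ (d - i) ≡ 1 [MOD l ^ c] := by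
      intro i c hc
      have e : r ^ d - r ^ (i : ℕ) = r ^ (i : ℕ) * (r ^ (d - i) - 1) := by
        rw [Nat.mul_sub, mul_one, ← pow_add, Nat.add_sub_cancel' i.2.le]
      rw [e] at hc
      have hco : (l ^ c).Coprime (r ^ (i : ℕ)) :=
        Nat.Coprime.pow _ _ ((Nat.Prime.coprime_iff_not_dvd hl).2 hlr)
      exact ((Nat.modEq_iff_dvd' (Nat.one_le_pow _ _ hr.pos)).2 (hco.dvd_of_dvd_mul_left hc)).symm
    obtain ⟨hx1, hx2⟩ := (hx l hl).2.2 hlp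
    have hmem : ∀ i : Fin d, d - i ∈ Finset.Icc 1 n := fun i ↦
      Finset.mem_Icc.2 ⟨by omega, by omega⟩
    by_cases hln : n + 1 < l
    · exfalso
      obtain ⟨i, -, hi⟩ := (Prime.dvd_finsetProd_iff hl.prime _).1
        ((dvd_pow_self l hkpos.ne').trans hk1)
      have h2 := hfactor i 1 (by simpa using hi)
      rw [pow_one] at h2
      exact hx1 hln _ (hmem i) ((((hrx.of_dvd (hdl l)).pow _).symm).trans h2)
    · push Not at hln
      have hk3 := le_mul_of_pow_dvd_prod hl (c := 2 * n) _ (fun i hi ↦ ?_) hk1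
      · refine Dvd.dvd.mul_right ?_ _
        exact (pow_dvd_pow l (hk3.trans (Nat.mul_le_mul_left _ hd))).trans
          (pow_dvd_pow_of_dvd ((hl.dvd_factorial).2 hln) _)
      · exact hx2 _ (hmem i) hln (((hrx.pow _).symm).trans (hfactor i _ hi))

end Residues

/-! ### Finite residue rings and exponents of their unit groups -/

section Finite

variable {R : Type*} [CommRing R] [IsDomain R] (K : Type*) [Field K] [NumberField K] [Algebra R K]
  [IsFractionRing R K]

-- As `R` need not be finitely generated over `ℤ`, lift the classes to `R`. The lifts span a free
-- `ℤ`-module `L` of rank at most `[K : ℚ]`, and distinct classes remain distinct in `L / m L`.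
include K in
theorem card_le_of_injOn_mk {m : ℕ} (hm : m ≠ 0) (s : Finset (R ⧸ Ideal.span {(m : R)})) :
    s.card ≤ m ^ finrank ℚ K := by
  classical
  have := charZero (R := R) K
  have : NeZero m := ⟨hm⟩
  set out : R ⧸ Ideal.span {(m : R)} → R := Function.surjInv Ideal.Quotient.mk_surjective
  have hout : ∀ x, Ideal.Quotient.mk _ (out x) = x :=
    Function.surjInv_eq Ideal.Quotient.mk_surjective
  set L : Submodule ℤ R := Submodule.span ℤ (s.image out : Set R)
  have hfin : Module.Finite ℤ L := Module.Finite.span_finset ℤ _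
  have : Module.IsTorsionFree ℤ L := inferInstance
  let b := Module.finBasis ℤ L
  set k := finrank ℤ L
  have hk : k ≤ finrank ℚ K := by
    have h1 : LinearIndependent ℤ (fun i ↦ algebraMap R K (b i)) := by
      have h2 := b.linearIndependent.map' L.subtype (Submodule.ker_subtype L)
      exact h2.map' (Algebra.linearMap R K |>.restrictScalars ℤ)
        (LinearMap.ker_eq_bot.2 (IsFractionRing.injective R K))
    have h3 := (LinearIndependent.iff_fractionRing ℤ ℚ).1 h1
    simpa using h3.fintype_card_le_finrank
  have hmem : ∀ x : s, out x ∈ L := fun x ↦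
    Submodule.subset_span (by simpa using ⟨x.1, x.2, rfl⟩)
  let φ : s → (Fin k → ZMod m) := fun x i ↦ (b.repr ⟨out x, hmem x⟩ i : ZMod m)
  have hφ : Function.Injective φ := by
    intro x y hxy
    have hdvd : ∀ i, (m : ℤ) ∣ b.repr ⟨out x, hmem x⟩ i - b.repr ⟨out y, hmem y⟩ i := fun i ↦ by
      have := congrFun hxy i
      simp only [φ] at this
      rw [ZMod.intCast_eq_intCast_iff] at this
      exact this.symm.dvd
    choose c hc using hdvd
    have hsub : (⟨out x, hmem x⟩ : L) - ⟨out y, hmem y⟩ = (m : ℤ) • ∑ i, c i • b i := by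
      rw [← b.sum_repr ⟨out x, hmem x⟩, ← b.sum_repr ⟨out y, hmem y⟩, ← Finset.sum_sub_distrib,
        Finset.smul_sum]
      refine Finset.sum_congr rfl fun i _ ↦ ?_
      rw [← sub_smul, smul_smul]
      congr 1
      simpa using hc i
    have hsub' := congrArg (Subtype.val) hsub
    ext
    rw [← hout x, ← hout y, Ideal.Quotient.eq, Ideal.mem_span_singleton]
    refine ⟨((∑ i, c i • b i : L) : R), ?_⟩
    rwa [Submodule.coe_sub, Submodule.coe_smul, zsmul_eq_mul, Int.cast_natCast] at hsub'
  have hcard := Fintype.card_le_of_injective φ hφ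
  rw [Fintype.card_coe, Fintype.card_fun, ZMod.card, Fintype.card_fin] at hcard
  exact hcard.trans (Nat.pow_le_pow_right (Nat.pos_of_ne_zero hm) hk)

include K in
theorem finite_quotient_natCast {m : ℕ} (hm : m ≠ 0) : Finite (R ⧸ Ideal.span {(m : R)}) := by
  by_contra h
  rw [not_finite_iff_infinite] at h
  obtain ⟨s, hs⟩ := Infinite.exists_subset_card_eq (R ⧸ Ideal.span {(m : R)})
    (m ^ finrank ℚ K + 1)
  have := card_le_of_injOn_mk K hm s
  omega

include K in
theorem card_quotient_natCast_le {m : ℕ} (hm : m ≠ 0) :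
    Nat.card (R ⧸ Ideal.span {(m : R)}) ≤ m ^ finrank ℚ K := by
  have := finite_quotient_natCast (R := R) K hm
  have := Fintype.ofFinite (R ⧸ Ideal.span {(m : R)})
  rw [Nat.card_eq_fintype_card]
  exact card_le_of_injOn_mk K hm Finset.univ

include K in
theorem finite_quotient {I : Ideal R} (hI : I ≠ ⊥) : Finite (R ⧸ I) := by
  obtain ⟨x, hx, hx0⟩ := I.ne_bot_iff.1 hI
  obtain ⟨m, hm, hd⟩ := exists_dvd_natCast K hx0
  have := finite_quotient_natCast (R := R) K hm
  refine Finite.of_surjective (Ideal.Quotient.factor (S := Ideal.span {(m : R)}) (T := I) ?_)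
    (Ideal.Quotient.factor_surjective _)
  rw [Ideal.span_singleton_le_iff_mem]
  exact I.mem_of_dvd hd hx

include K in
theorem exists_dvd_units_pow_sub_one (v : Rˣ) {x : R} (hx : x ≠ 0) :
    ∃ j : ℕ, j ≠ 0 ∧ x ∣ (v : R) ^ j - 1 := by
  have := finite_quotient K (I := Ideal.span {x}) (by simpa using hx)
  have hpos := Nat.card_pos (α := (R ⧸ Ideal.span {x})ˣ)
  refine ⟨Nat.card (R ⧸ Ideal.span {x})ˣ, hpos.ne', ?_⟩
  have h := pow_card_eq_one' (x := Units.map (↑(Ideal.Quotient.mk (Ideal.span {x})) :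
    R →* R ⧸ Ideal.span {x}) v)
  have h2 := congrArg Units.val h
  rw [← Ideal.mem_span_singleton, ← Ideal.Quotient.eq]
  simpa only [Units.val_pow_eq_pow_val, Units.coe_map, MonoidHom.coe_coe, Units.val_one, map_pow,
    map_one] using h2

/-- Multiplication embeds `Mˣ` in `GL_d(𝔽_r)`; apply Lagrange there. No structure theory of `M` is
needed. -/
theorem units_pow_card_GL_eq_one_of_algebra {M : Type*} [CommRing M] [Finite M] {r : ℕ}
    [Fact r.Prime] [Algebra (ZMod r) M] (v : Mˣ) :
    v ^ (∏ i : Fin (finrank (ZMod r) M), (r ^ finrank (ZMod r) M - r ^ (i : ℕ))) = 1 := by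
  have : Module.Finite (ZMod r) M := Module.Finite.of_finite
  set d := finrank (ZMod r) M
  have hcard : Nat.card (Module.End (ZMod r) M)ˣ = ∏ i : Fin d, (r ^ d - r ^ (i : ℕ)) := by
    rw [Nat.card_congr (Units.mapEquiv
      (LinearMap.toMatrixAlgEquiv (Module.finBasis (ZMod r) M)).toMulEquiv).toEquiv]
    have := Matrix.card_GL_field (𝔽 := ZMod r) d
    rwa [ZMod.card] at this
  have h := pow_card_eq_one'
    (x := Units.map (↑(Algebra.lmul (ZMod r) M) : M →* Module.End (ZMod r) M) v)
  rw [hcard, ← map_pow] at h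
  ext
  have h2 := LinearMap.congr_fun (congrArg Units.val h) 1
  rw [Units.coe_map, MonoidHom.coe_coe, Algebra.coe_lmul_eq_mul, LinearMap.mul_apply', mul_one]
    at h2
  exact h2

theorem units_pow_card_GL_eq_one {M : Type*} [CommRing M] [Finite M] {r : ℕ} (hr : r.Prime)
    (hr0 : (r : M) = 0) :
    ∃ d, Nat.card M = r ^ d ∧ ∀ v : Mˣ, v ^ (∏ i : Fin d, (r ^ d - r ^ (i : ℕ))) = 1 := by
  have := Fact.mk hr
  rcases subsingleton_or_nontrivial M with hM | hM
  · exact ⟨0, by simp, fun v ↦ Subsingleton.elim _ _⟩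
  have : CharP M r := ringChar.of_eq
    (((Nat.dvd_prime hr).1 (ringChar.dvd hr0)).resolve_left CharP.ringChar_ne_one)
  let _ : Algebra (ZMod r) M := ZMod.algebra M r
  refine ⟨finrank (ZMod r) M, ?_, units_pow_card_GL_eq_one_of_algebra⟩
  have : Module.Finite (ZMod r) M := Module.Finite.of_finite
  have h1 := Module.natCard_eq_pow_finrank (K := ZMod r) (V := M)
  rwa [Nat.card_zmod] at h1

include K in
theorem exists_dvd_units_pow_card_GL_sub_one (v : Rˣ) {r : ℕ} (hr : r.Prime) :
    ∃ d ≤ finrank ℚ K, (r : R) ∣ (v : R) ^ (∏ i : Fin d, (r ^ d - r ^ (i : ℕ))) - 1 := by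
  have hfin := finite_quotient_natCast (R := R) K hr.ne_zero
  have hr0 : (r : R ⧸ Ideal.span {(r : R)}) = 0 := by
    rw [← map_natCast (Ideal.Quotient.mk (Ideal.span {(r : R)})), Ideal.Quotient.eq_zero_iff_mem]
    exact Ideal.mem_span_singleton_self _
  obtain ⟨d, hd, h⟩ := units_pow_card_GL_eq_one hr hr0
  refine ⟨d, ?_, ?_⟩
  · have h2 := card_quotient_natCast_le (R := R) K hr.ne_zero
    rw [hd] at h2
    exact (Nat.pow_le_pow_iff_right hr.one_lt).1 h2
  · have h2 := congrArg Units.val (h (Units.map (↑(Ideal.Quotient.mk (Ideal.span {(r : R)})) :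
      R →* R ⧸ Ideal.span {(r : R)}) v))
    rw [← Ideal.mem_span_singleton, ← Ideal.Quotient.eq]
    simpa using h2

end Finite

end NumberRing

/-! ### Elementary matrices in `N` and commutators with diagonal matrices -/

namespace SL2

open NumberRing Module

section Ring

variable {R : Type*} [CommRing R]

theorem conj_upper_of_lower_left_eq_zero {Y : SL(2, R)} (h : Y 1 0 = 0) (t : R) :
    Y * upper t * Y⁻¹ = upper (Y 0 0 ^ 2 * t) := by
  have hd := det_eq Y
  rw [h, mul_zero, sub_zero] at hd
  apply ext <;> simp [h]
  · linear_combination hd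
  · ring
  · linear_combination hd

/-- Used over `R` for units congruent to `1`, and over `K` for the inverse of a rational prime. -/
theorem diag_eq_of_eq_one_add_mul (ξ : Rˣ) {p q : R} (h : (ξ : R) = 1 + p * q) :
    diag ξ = lower (-q * ↑ξ⁻¹) * upper p * lower q * upper (-p * ↑ξ⁻¹) := by
  have h1 : (ξ : R) * ↑ξ⁻¹ = 1 := ξ.mul_inv
  apply ext <;> simp
  · exact h
  · linear_combination p * h1 - p * (↑ξ⁻¹ : R) * h
  · linear_combination q * h1 - q * (↑ξ⁻¹ : R) * h
  · generalize (↑ξ⁻¹ : R) = η at *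
    rw [h] at h1
    linear_combination (1 - p * q * η) * h1

theorem diag_mem_of_dvd_sub_one {H : Subgroup SL(2, R)} {q : R}
    (hup : ∀ t, upper (q * t) ∈ H) (hlow : ∀ t, lower (q * t) ∈ H) {ξ : Rˣ}
    (h : q ^ 2 ∣ (ξ : R) - 1) : diag ξ ∈ H := by
  obtain ⟨z, hz⟩ := h
  rw [diag_eq_of_eq_one_add_mul ξ (p := q * z) (q := q) (by linear_combination hz)]
  refine H.mul_mem (H.mul_mem (H.mul_mem ?_ (hup _)) ?_) ?_
  · rw [neg_mul_comm]; exact hlow _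
  · rw [← mul_one q]; exact hlow _
  · rw [neg_mul_comm, mul_assoc]; exact hup _

theorem dvd_units_zpow_sub_one {x : R} {v : Rˣ} (h : x ∣ (v : R) - 1) (i : ℤ) :
    x ∣ ((v ^ i : Rˣ) : R) - 1 := by
  have key : ∀ w : Rˣ, x ∣ (w : R) - 1 ↔
      Units.map (↑(Ideal.Quotient.mk (Ideal.span {x})) : R →* R ⧸ Ideal.span {x}) w = 1 := by
    intro w
    rw [← Ideal.mem_span_singleton, ← Ideal.Quotient.eq, Units.ext_iff]
    simp only [map_one, Units.coe_map, MonoidHom.coe_coe, Units.val_one]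
  rw [key] at h ⊢
  rw [map_zpow, h, one_zpow]

/-- Conjugation scales the off-diagonal entries by `v ^ 2` and `v ^ (-2)`. These changes are
multiples of the pivot `r`, so one row and one column operation of level `q` produce them. -/
theorem diag_conj_eq {r q : R} {X : SL(2, R)} (hX : X 0 0 = r) (hb : q ∣ X 0 1)
    (hc : q ∣ X 1 0) {v : Rˣ} (hv : r ∣ (v : R) - 1) :
    ∃ s t, diag v * X * (diag v)⁻¹ = lower (q * s) * X * upper (q * t) := by
  obtain ⟨z, hz⟩ := hv
  obtain ⟨b, hb⟩ := hb
  obtain ⟨c, hc⟩ := hc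
  have h1 : (v : R) * ↑v⁻¹ = 1 := v.mul_inv
  have hd := det_eq X
  refine ⟨-(↑v⁻¹ : R) ^ 2 * (z * (v + 1)) * c, z * (v + 1) * b, ?_⟩
  have h10 : (↑v⁻¹ : R) * X 1 0 * ↑v⁻¹ =
      -(q * ((↑v⁻¹ : R) ^ 2 * (z * (v + 1)) * c) * X 0 0) + X 1 0 := by
    linear_combination -(↑v⁻¹ : R) ^ 2 * (v + 1) * X 0 0 * z * hc +
      (↑v⁻¹ : R) ^ 2 * (v + 1) * X 1 0 * (z * hX - hz) + X 1 0 * (v * ↑v⁻¹ + 1) * h1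
  apply ext <;> simp
  · linear_combination X 0 0 * h1
  · linear_combination X 0 1 * (v + 1) * (hz - z * hX) + X 0 0 * z * (v + 1) * hb
  · exact h10
  · linear_combination X 1 1 * h1 + z * (v + 1) * q * b * h10 -
      (↑v⁻¹ : R) ^ 2 * z * (v + 1) * (X 0 1 * hc - X 1 0 * hb)

variable {K : Type*} [Field K] [NumberField K] [IsDomain R] [Algebra R K] [IsFractionRing R K]

variable (K) in
include K in
/-- A nonscalar normal subgroup contains an elementary subgroup of some level. -/
theorem exists_upper_mem {u : Rˣ} (hu : ∀ j : ℕ, j ≠ 0 → u ^ j ≠ 1)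
    {N : Subgroup SL(2, R)} [hN : N.Normal] {X : SL(2, R)} (hX : X ∈ N) (hc : X 1 0 ≠ 0) :
    ∃ q : ℕ, q ≠ 0 ∧ ∀ t : R, upper ((q : R) * t) ∈ N := by
  obtain ⟨j, hj, e, he⟩ := exists_dvd_units_pow_sub_one K u hc
  set v := u ^ j with hv
  rw [← Units.val_pow_eq_pow_val, ← hv] at he
  have hvi : (v : R) * ↑v⁻¹ = 1 := v.mul_inv
  have hd := det_eq X
  -- The upper right entry is chosen so that `X⁻¹ z X z⁻¹` is upper triangular with first entry `v ^
  -- (-2)`; this needs `X 1 0 ∣ v - 1`. Its commutator with `upper s` is then `upper ((v ^ (-4) - 1)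
  -- s)`.
  set z := mk (v : R) (-((v : R) + 1) * ↑v⁻¹ * e * X 0 0) 0 ↑v⁻¹ (by simp) with hz
  set Y := X⁻¹ * (z * X * z⁻¹)
  have hY : Y ∈ N := N.mul_mem (N.inv_mem hX) (hN.conj_mem X hX z)
  have hY1 : Y 1 0 = 0 := by
    simp [Y, z]
    linear_combination -X 1 0 * X 0 0 * (↑v⁻¹ : R) * (-v * hvi + (1 + v) * ↑v⁻¹ * he)
  have hY0 : Y 0 0 = (↑v⁻¹ : R) ^ 2 := by
    simp [Y, z]
    linear_combination X 1 1 * (↑v⁻¹ : R) * X 0 0 * (-v * hvi + (1 + v) * ↑v⁻¹ * he) +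
      (↑v⁻¹ : R) ^ 2 * hd
  have hne : ((↑v⁻¹ : R) ^ 2) ^ 2 - 1 ≠ 0 := by
    intro h
    refine hu (4 * j) (by omega) ?_
    have h2 : (v⁻¹) ^ 4 = 1 := by
      ext
      push_cast
      linear_combination h
    rw [inv_pow, inv_eq_one, hv, ← pow_mul] at h2
    rw [mul_comm]; exact h2
  obtain ⟨q, hq, y, hy⟩ := exists_dvd_natCast K hne
  refine ⟨q, hq, fun t ↦ ?_⟩
  have h1 := N.mul_mem hY (hN.conj_mem _ (N.inv_mem hY) (upper (y * t)))
  have h2 : Y * (upper (y * t) * Y⁻¹ * (upper (y * t))⁻¹) = upper (q * t) := by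
    rw [← mul_assoc, ← mul_assoc, conj_upper_of_lower_left_eq_zero hY1, hY0, ← upper_neg,
      ← upper_add, hy]
    congr 1
    ring
  rwa [h2] at h1

variable (K) in
include K in
/-- Elementary operations of level `Q` bring a matrix to a form with a prime as first entry. -/
theorem exists_prime_entry {Q : ℕ} (hQ : Q ≠ 0) (hn : (finrank ℚ K).factorial ∣ Q) {ρ : ℤ}
    (hρ : IsCoprime ρ (Q : ℤ)) {X : SL(2, R)} (ha : (Q : R) ^ 2 ∣ X 0 0 - ρ)
    (hb : (Q : R) ∣ X 0 1) (hc : (Q : R) ∣ X 1 0) (B : ℕ) :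
    ∃ (s t : R) (r : ℕ), r.Prime ∧ B < r ∧ (r : ℤ) ≡ ρ [ZMOD (Q ^ 2 : ℕ)] ∧
      (X * upper (Q * s) * lower (Q * t)) 0 0 = r ∧
      (Q : R) ∣ (X * upper (Q * s) * lower (Q * t)) 0 1 ∧
      (Q : R) ∣ (X * upper (Q * s) * lower (Q * t)) 1 0 := by
  obtain ⟨b, hb⟩ := hb
  obtain ⟨c, hc⟩ := hc
  have hd := det_eq X
  -- With `X 0 1 = Q b`, the operations `upper (Q s)` and `lower (Q t)` add `Q ^ 2 (b + a s) t` to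
  -- the first entry `a`, hence the exponent 2.
  have hab : IsCoprime (X 0 0) b := ⟨X 1 1, -(Q * X 1 0), by rw [hb] at hd; linear_combination hd⟩
  obtain ⟨s, t, r, hr, hB, hmod, h⟩ := exists_prime_eq_add K hQ hn hρ hab ha B
  refine ⟨s, t, r, hr, hB, hmod, ?_, ?_, ?_⟩
  · simp [hb, h]; ring
  · exact ⟨b + X 0 0 * s, by simp [hb]; ring⟩
  · exact ⟨c + (Q * c * (Q * s) + X 1 1) * t, by simp [hc]; ring⟩

include K in
/-- Powers of a diagonal matrix whose exponent is divisible by all the common divisors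
of `w` and the orders of general linear groups over suitable prime fields commute
with a congruence coset modulo elementary matrices. -/
theorem commutator_diag_mem {N G : Subgroup SL(2, R)} (hNG : N ≤ G)
    (hG : ∀ g ∈ G, ∀ x ∈ N, g * x * g⁻¹ ∈ N) {Q₀ Q : ℕ} (hQ : Q ≠ 0) (hQ₀ : Q₀ ∣ Q)
    (hn : (finrank ℚ K).factorial ∣ Q)
    (hup : ∀ t : R, upper ((Q₀ : R) * t) ∈ N) (hlow : ∀ t : R, lower ((Q₀ : R) * t) ∈ N)
    {u : Rˣ} {w : ℕ} (hw : (Q₀ : R) ^ 2 ∣ (u : R) ^ w - 1) {ρ : ℤ} (hρ : IsCoprime ρ (Q : ℤ))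
    {M : ℕ} (hM : ∀ r : ℕ, r.Prime → (r : ℤ) ≡ ρ [ZMOD (Q ^ 2 : ℕ)] → ∀ d ≤ finrank ℚ K,
      (∏ i : Fin d, (r ^ d - r ^ (i : ℕ))).gcd w ∣ M)
    {X : SL(2, R)} (hX : X ∈ G) (ha : (Q : R) ^ 2 ∣ X 0 0 - ρ) (hb : (Q : R) ∣ X 0 1)
    (hc : (Q : R) ∣ X 1 0) : diag (u ^ M) * X * (diag (u ^ M))⁻¹ * X⁻¹ ∈ N := by
  obtain ⟨s, t, r, hr, -, hmod, h00, h01, h10⟩ := exists_prime_entry K hQ hn hρ ha hb hc 0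
  obtain ⟨d, hd, hdvd⟩ := exists_dvd_units_pow_card_GL_sub_one K u hr
  have hgcd := hM r hr hmod d hd
  set m := ∏ i : Fin d, (r ^ d - r ^ (i : ℕ))
  -- Bézout splits `u ^ M` into a power of `u ^ w`, whose diagonal matrix lies in `N`, and a power
  -- of `u ^ m`, which is `1` modulo `r`.
  obtain ⟨i, j, hij⟩ := Int.gcd_dvd_iff.1 (show Int.gcd m w ∣ M by simpa using hgcd)
  have huM : u ^ M = (u ^ w) ^ j * (u ^ m) ^ i := by
    rw [← zpow_natCast, hij, zpow_add, zpow_mul, zpow_mul, zpow_natCast, zpow_natCast, mul_comm]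
  have hupQ : ∀ t : R, upper ((Q : R) * t) ∈ N := fun t ↦ by
    obtain ⟨k, rfl⟩ := hQ₀
    rw [Nat.cast_mul, mul_assoc]; exact hup _
  have hlowQ : ∀ t : R, lower ((Q : R) * t) ∈ N := fun t ↦ by
    obtain ⟨k, rfl⟩ := hQ₀
    rw [Nat.cast_mul, mul_assoc]; exact hlow _
  have hD : diag ((u ^ w) ^ j) ∈ N := by
    refine diag_mem_of_dvd_sub_one hup hlow (dvd_units_zpow_sub_one ?_ j)
    rwa [Units.val_pow_eq_pow_val]
  set Y := X * upper (Q * s) * lower (Q * t) with hYdef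
  have hYG : Y ∈ G := G.mul_mem (G.mul_mem hX (hNG (hupQ _))) (hNG (hlowQ _))
  obtain ⟨s', t', hconj⟩ := diag_conj_eq h00 h01 h10 (v := (u ^ m) ^ i)
    (dvd_units_zpow_sub_one (by rwa [Units.val_pow_eq_pow_val]) i)
  have h1 : diag ((u ^ m) ^ i) * Y * (diag ((u ^ m) ^ i))⁻¹ * Y⁻¹ ∈ N := by
    rw [hconj, mul_assoc (lower _ * Y), mul_assoc (lower _), ← mul_assoc Y]
    exact N.mul_mem (hlowQ _) (hG _ hYG _ (hupQ _))
  have h2 : diag (u ^ M) * Y * (diag (u ^ M))⁻¹ * Y⁻¹ ∈ N := by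
    have e : diag (u ^ M) * Y * (diag (u ^ M))⁻¹ * Y⁻¹ = diag ((u ^ w) ^ j) *
        (diag ((u ^ m) ^ i) * Y * (diag ((u ^ m) ^ i))⁻¹ * Y⁻¹) *
        (Y * (diag ((u ^ w) ^ j))⁻¹ * Y⁻¹) := by
      rw [huM, diag_mul]
      group
    rw [e]
    exact N.mul_mem (N.mul_mem hD h1) (hG _ hYG _ (N.inv_mem hD))
  set D := diag (u ^ M)
  set E := upper ((Q : R) * s) * lower ((Q : R) * t) with hE
  have hEN : E ∈ N := N.mul_mem (hupQ _) (hlowQ _)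
  have hDE : D * E * D⁻¹ ∈ N := by
    have e : D * E * D⁻¹ = (D * upper ((Q : R) * s) * D⁻¹) * (D * lower ((Q : R) * t) * D⁻¹) := by
      rw [hE]; group
    rw [e, diag_conj_upper, diag_conj_lower]
    refine N.mul_mem ?_ ?_
    · rw [mul_left_comm]; exact hupQ _
    · rw [mul_left_comm]; exact hlowQ _
  have e : D * X * D⁻¹ * X⁻¹ = D * Y * D⁻¹ * Y⁻¹ * (X * (E * (D * E * D⁻¹)⁻¹) * X⁻¹) := by
    rw [hYdef, mul_assoc X, ← hE]
    group
  rw [e]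
  exact N.mul_mem h2 (hG _ hX _ (N.mul_mem hEN (N.inv_mem hDE)))

end Ring

end SL2

/-! ### The germ centralizer -/

namespace SL2

open NumberRing Module

section Fraction

variable {R : Type*} [CommRing R] [IsDomain R] {K : Type*} [Field K] [NumberField K] [Algebra R K]
  [IsFractionRing R K]

variable (R K) in
/-- The inclusion of `SL₂(R)` into `SL₂(K)`. -/
abbrev incl : SL(2, R) →* SL(2, K) := Matrix.SpecialLinearGroup.map (algebraMap R K)

omit [IsDomain R] [NumberField K] in
theorem incl_injective : Function.Injective (incl R K) := by
  intro X Y h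
  have key : ∀ i j, X i j = Y i j := fun i j ↦ IsFractionRing.injective R K (by
    rw [← map_entry, ← map_entry]; exact congrArg (fun Z : SL(2, K) ↦ Z i j) h)
  exact ext (key _ _) (key _ _) (key _ _) (key _ _)

omit [IsDomain R] [NumberField K] in
theorem exists_incl_eq {Z : SL(2, K)} {a b c d : R} (ha : algebraMap R K a = Z 0 0)
    (hb : algebraMap R K b = Z 0 1) (hc : algebraMap R K c = Z 1 0)
    (hd : algebraMap R K d = Z 1 1) :
    ∃ X : SL(2, R), incl R K X = Z ∧ X 0 0 = a ∧ X 0 1 = b ∧ X 1 0 = c ∧ X 1 1 = d := by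
  have h : a * d - b * c = 1 := IsFractionRing.injective R K (by
    rw [map_sub, map_mul, map_mul, ha, hb, hc, hd, det_eq, map_one])
  exact ⟨mk a b c d h, ext (by simpa) (by simpa) (by simpa) (by simpa), rfl, rfl, rfl, rfl⟩

theorem exists_natCast_mul_eq_algebraMap (x : K) :
    ∃ m : ℕ, m ≠ 0 ∧ ∃ y : R, algebraMap R K y = m * x := by
  obtain ⟨a, b, hb, rfl⟩ := IsFractionRing.div_surjective (A := R) x
  obtain ⟨m, hm, w, hw⟩ := exists_dvd_natCast K (nonZeroDivisors.ne_zero hb)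
  refine ⟨m, hm, a * w, ?_⟩
  have hb0 : algebraMap R K b ≠ 0 := by simpa using nonZeroDivisors.ne_zero hb
  rw [← map_natCast (algebraMap R K) m, hw, map_mul, map_mul]
  field_simp

/-- Conjugation by an element of `SL₂(K)` is continuous for the congruence topology. -/
theorem exists_conj_mem_principal (γ : SL(2, K)) {m : ℕ} (hm : m ≠ 0) :
    ∃ m' : ℕ, m' ≠ 0 ∧ ∀ B ∈ principal (Ideal.span {(m' : R)}),
      ∃ B' ∈ principal (Ideal.span {(m : R)}), incl R K B' = γ * incl R K B * γ⁻¹ := by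
  have hex := fun i j ↦ exists_natCast_mul_eq_algebraMap (R := R) (γ i j)
  choose n hn y hy using hex
  set D := n 0 0 * n 0 1 * n 1 0 * n 1 1 with hD
  obtain ⟨p, hp⟩ : ∃ p : R, algebraMap R K p = D * γ 0 0 :=
    ⟨n 0 1 * n 1 0 * n 1 1 * y 0 0, by simp [hD, hy]; ring⟩
  obtain ⟨q, hq⟩ : ∃ p : R, algebraMap R K p = D * γ 0 1 :=
    ⟨n 0 0 * n 1 0 * n 1 1 * y 0 1, by simp [hD, hy]; ring⟩
  obtain ⟨r, hr⟩ : ∃ p : R, algebraMap R K p = D * γ 1 0 :=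
    ⟨n 0 0 * n 0 1 * n 1 1 * y 1 0, by simp [hD, hy]; ring⟩
  obtain ⟨s, hs⟩ : ∃ p : R, algebraMap R K p = D * γ 1 1 :=
    ⟨n 0 0 * n 0 1 * n 1 0 * y 1 1, by simp [hD, hy]; ring⟩
  have hdet := det_eq γ
  -- One factor `D` clears the denominators of `γ`, the other those of `γ⁻¹`.
  refine ⟨D ^ 2 * m, by simp [hD, hn, hm], fun B hB ↦ ?_⟩
  simp only [mem_principal, Ideal.mem_span_singleton] at hB
  obtain ⟨⟨a, ha⟩, ⟨b, hb⟩, ⟨c, hc⟩, ⟨d, hd⟩⟩ := hB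
  have ha' := congrArg (algebraMap R K) ha
  have hb' := congrArg (algebraMap R K) hb
  have hc' := congrArg (algebraMap R K) hc
  have hd' := congrArg (algebraMap R K) hd
  simp only [Nat.cast_mul, Nat.cast_pow, map_sub, map_mul, map_one, map_pow, map_natCast]
    at ha' hb' hc' hd'
  obtain ⟨B', hB', h00, h01, h10, h11⟩ := exists_incl_eq (Z := γ * incl R K B * γ⁻¹)
    (a := 1 + m * ((p * a + q * c) * s - (p * b + q * d) * r))
    (b := m * (-(p * a + q * c) * q + (p * b + q * d) * p))
    (c := m * ((r * a + s * c) * s - (r * b + s * d) * r))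
    (d := 1 + m * (-(r * a + s * c) * q + (r * b + s * d) * p)) (by
      simp [hp, hq, hr, hs]
      linear_combination -hdet - γ 0 0 * γ 1 1 * ha' - γ 0 1 * γ 1 1 * hc' +
        γ 0 0 * γ 1 0 * hb' + γ 0 1 * γ 1 0 * hd') (by
      simp [hp, hq]
      linear_combination γ 0 0 * γ 0 1 * ha' + γ 0 1 * γ 0 1 * hc' -
        γ 0 0 * γ 0 0 * hb' - γ 0 1 * γ 0 0 * hd') (by
      simp [hr, hs]
      linear_combination -γ 1 0 * γ 1 1 * ha' - γ 1 1 * γ 1 1 * hc' +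
        γ 1 0 * γ 1 0 * hb' + γ 1 1 * γ 1 0 * hd') (by
      simp [hp, hq, hr, hs]
      linear_combination -hdet + γ 1 0 * γ 0 1 * ha' + γ 1 1 * γ 0 1 * hc' -
        γ 1 0 * γ 0 0 * hb' - γ 1 1 * γ 0 0 * hd')
  refine ⟨B', ?_, hB'⟩
  simp only [mem_principal, Ideal.mem_span_singleton, h00, h01, h10, h11]
  exact ⟨⟨_, by rw [add_sub_cancel_left]⟩, ⟨_, rfl⟩, ⟨_, rfl⟩, ⟨_, by rw [add_sub_cancel_left]⟩⟩

variable (K) in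
/-- The elements of `SL₂(K)` that act trivially by conjugation modulo `N` on some principal
congruence subgroup. -/
def germCentralizer (N : Subgroup SL(2, R)) : Subgroup SL(2, K) where
  carrier := {γ | ∃ m : ℕ, m ≠ 0 ∧ ∀ B ∈ principal (Ideal.span {(m : R)}),
    γ * incl R K B * γ⁻¹ * (incl R K B)⁻¹ ∈ N.map (incl R K)}
  one_mem' := ⟨1, one_ne_zero, fun B _ ↦ by
    rw [one_mul, inv_one, mul_one, mul_inv_cancel]; exact Subgroup.one_mem _⟩
  mul_mem' := by
    rintro γ δ ⟨m, hm, hγ⟩ ⟨n, hn, hδ⟩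
    obtain ⟨m', hm', h⟩ := exists_conj_mem_principal (R := R) δ hm
    refine ⟨n * m', mul_ne_zero hn hm', fun B hB ↦ ?_⟩
    have hB1 : B ∈ principal (Ideal.span {(n : R)}) := principal_mono
      (by rw [Ideal.span_singleton_le_span_singleton]; exact ⟨m', by push_cast; rfl⟩) hB
    have hB2 : B ∈ principal (Ideal.span {(m' : R)}) := principal_mono
      (by rw [Ideal.span_singleton_le_span_singleton]; exact ⟨n, by push_cast; ring⟩) hB
    obtain ⟨B', hB', e⟩ := h B hB2
    have := Subgroup.mul_mem _ (hγ B' hB') (hδ B hB1)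
    rw [← e] at this
    convert this using 1
    have e' : γ * δ * incl R K B * (γ * δ)⁻¹ = γ * incl R K B' * γ⁻¹ := by
      rw [e]; group
    rw [e']
    group
  inv_mem' := by
    rintro γ ⟨m, hm, hγ⟩
    obtain ⟨m', hm', h⟩ := exists_conj_mem_principal (R := R) γ⁻¹ hm
    refine ⟨m', hm', fun B hB ↦ ?_⟩
    obtain ⟨B', hB', e⟩ := h B hB
    have := Subgroup.inv_mem _ (hγ B' hB')
    rw [← e]
    convert this using 1
    rw [e]
    group

variable {N : Subgroup SL(2, R)} [hN : N.Normal]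

omit hN in
theorem mem_germCentralizer {γ : SL(2, K)} : γ ∈ germCentralizer K N ↔
    ∃ m : ℕ, m ≠ 0 ∧ ∀ B ∈ principal (Ideal.span {(m : R)}),
    γ * incl R K B * γ⁻¹ * (incl R K B)⁻¹ ∈ N.map (incl R K) := Iff.rfl

theorem incl_mem_germCentralizer {g : SL(2, R)} (hg : g ∈ N) :
    incl R K g ∈ germCentralizer K N := by
  refine ⟨1, one_ne_zero, fun B _ ↦ ⟨g * (B * g⁻¹ * B⁻¹),
    N.mul_mem hg (hN.conj_mem _ (N.inv_mem hg) _), ?_⟩⟩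
  simp only [map_mul, map_inv, mul_assoc]

theorem conj_mem_germCentralizer {γ : SL(2, K)} (hγ : γ ∈ germCentralizer K N) (g : SL(2, R)) :
    incl R K g * γ * (incl R K g)⁻¹ ∈ germCentralizer K N := by
  obtain ⟨m, hm, h⟩ := hγ
  refine ⟨m, hm, fun B hB ↦ ?_⟩
  obtain ⟨x, hx, e⟩ := h (g⁻¹ * B * g) (by
    simpa using (inferInstance : (principal _).Normal).conj_mem B hB g⁻¹)
  refine ⟨g * x * g⁻¹, hN.conj_mem x hx g, ?_⟩
  rw [map_mul, map_mul, e]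
  simp only [map_mul, map_inv]
  group

theorem lower_mem_germCentralizer {q : K} (h : ∀ t : R, upper (q * algebraMap R K t) ∈
    germCentralizer K N) (t : R) : lower (q * algebraMap R K t) ∈ germCentralizer K N := by
  have := conj_mem_germCentralizer (h (-t)) weyl
  have e : incl R K weyl = weyl := by
    apply ext <;> simp [weyl]
  rw [e, weyl_conj_upper] at this
  simpa using this

omit [IsDomain R] in
theorem lower_mem {q : R} (h : ∀ t : R, upper (q * t) ∈ N) (t : R) : lower (q * t) ∈ N := by
  have := hN.conj_mem _ (h (-t)) weyl
  rw [weyl_conj_upper] at this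
  simpa using this

end Fraction

end SL2

/-! ### Denominators in the germ centralizer, and triviality of the quotient -/

namespace SL2

open NumberRing Module

section Fraction

variable {R : Type*} [CommRing R] [IsDomain R] {K : Type*} [Field K] [NumberField K] [Algebra R K]
  [IsFractionRing R K] {N : Subgroup SL(2, R)} [hN : N.Normal]

omit hN in
omit [IsDomain R] in
theorem conj_upper_div_mem_range {p : ℕ} (hp : p ≠ 0) (t : R) {X : SL(2, R)}
    (hc : (p : R) ^ 2 ∣ X 1 0) (had : (p : R) ∣ X 0 0 - X 1 1) :
    upper (algebraMap R K t / p) * incl R K X * (upper (algebraMap R K t / p))⁻¹ ∈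
      (incl R K).range := by
  have hp' : (p : K) ≠ 0 := by exact_mod_cast hp
  obtain ⟨c, hc⟩ := hc
  obtain ⟨e, he⟩ := had
  have hc' := congrArg (algebraMap R K) hc
  have he' := congrArg (algebraMap R K) he
  simp only [map_mul, map_pow, map_natCast, map_sub] at hc' he'
  obtain ⟨Y, hY, -⟩ := exists_incl_eq (R := R)
    (Z := upper (algebraMap R K t / p) * incl R K X * (upper (algebraMap R K t / p))⁻¹)
    (a := X 0 0 + t * p * c) (b := X 0 1 - t * e - t ^ 2 * c) (c := X 1 0)
    (d := X 1 1 - t * p * c) (by simp [hc']; field_simp)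
    (by simp [hc']; field_simp; linear_combination algebraMap R K t * he')
    (by simp) (by simp [hc']; field_simp; ring)
  exact ⟨Y, hY⟩

-- The conjugate is a unipotent fixing the vector `(t, p)`. This is the first column of some `g ∈
-- SL₂(R)`, so the conjugate equals `g * upper (-q s) * g⁻¹`.
omit [IsDomain R] [IsFractionRing R K] in
theorem conj_upper_div_lower_mem {q p : ℕ} (hp : p ≠ 0) (hq : ∀ t : R, upper ((q : R) * t) ∈ N)
    {t : R} (ht : IsCoprime t (p : R)) (s : R) :
    upper (algebraMap R K t / p) * incl R K (lower (((q * p ^ 2 : ℕ) : R) * s)) *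
      (upper (algebraMap R K t / p))⁻¹ ∈ N.map (incl R K) := by
  have hp' : (p : K) ≠ 0 := by exact_mod_cast hp
  obtain ⟨g, hg0, hg1⟩ := ht.exists_SL2_col 0
  refine ⟨g * upper (q * (-s)) * g⁻¹, hN.conj_mem _ (hq _) g, ?_⟩
  have hd := congrArg (algebraMap R K) (det_eq g)
  simp only [hg0, hg1, map_sub, map_mul, map_one, map_natCast] at hd
  apply ext <;> simp [hg0, hg1] <;> field_simp
  · linear_combination hd
  · ring
  · ring
  · linear_combination hd

omit [IsDomain R] in
theorem conj_mem_comap_map {G : Type*} [Group G] {k : G} {ι : SL(2, R) →* G} {g x : SL(2, R)}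
    (hg : k * ι g * k⁻¹ ∈ ι.range) (hx : k * ι x * k⁻¹ ∈ N.map ι) :
    k * ι (g * x * g⁻¹) * k⁻¹ ∈ N.map ι := by
  obtain ⟨g', hg'⟩ := hg
  obtain ⟨x', hx', hx⟩ := hx
  refine ⟨g' * x' * g'⁻¹, hN.conj_mem _ hx' _, ?_⟩
  rw [map_mul, map_mul, map_inv, hg', hx, map_mul, map_mul, map_inv]
  group

/-- If the commutators of `D` with `A` and `A * B` are conjugate into `N` for all `B` in a
principal congruence subgroup, then the conjugate of `D` lies in the germ centralizer. -/
theorem conj_mem_germCentralizer_of_commutator {k : SL(2, K)} {D A : SL(2, R)} {m : ℕ}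
    (hm : m ≠ 0) (hA : k * incl R K A * k⁻¹ ∈ (incl R K).range)
    (h : ∀ B ∈ principal (Ideal.span {(m : R)}), k * incl R K B * k⁻¹ ∈ (incl R K).range →
      k * incl R K (D * (A * B) * D⁻¹ * (A * B)⁻¹) * k⁻¹ ∈ N.map (incl R K)) :
    k * incl R K D * k⁻¹ ∈ germCentralizer K N := by
  obtain ⟨m', hm', hconj⟩ := exists_conj_mem_principal (R := R) k⁻¹ hm
  refine mem_germCentralizer.2 ⟨m', hm', fun B hB ↦ ?_⟩
  obtain ⟨B', hB', e⟩ := hconj B hB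
  have hfB : k * incl R K B' * k⁻¹ = incl R K B := by rw [e]; group
  have h1 := h 1 (Subgroup.one_mem _) (by simp)
  have h2 := h B' hB' ⟨B, hfB.symm⟩
  have h3 : k * incl R K A⁻¹ * k⁻¹ ∈ (incl R K).range := by
    have := Subgroup.inv_mem _ hA
    rwa [mul_inv_rev, mul_inv_rev, inv_inv, ← map_inv, ← mul_assoc] at this
  -- The identity `A⁻¹ [D, A]⁻¹ [D, A B'] A = [D, B']` passes from the coset of `A` to the
  -- congruence subgroup itself.
  have h4 := conj_mem_comap_map (N := N) (x := (D * (A * 1) * D⁻¹ * (A * 1)⁻¹)⁻¹ *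
    (D * (A * B') * D⁻¹ * (A * B')⁻¹)) h3 (by
      have := Subgroup.mul_mem _ (Subgroup.inv_mem _ h1) h2
      rw [map_mul, map_inv]
      generalize incl R K (D * (A * 1) * D⁻¹ * (A * 1)⁻¹) = x at *
      generalize incl R K (D * (A * B') * D⁻¹ * (A * B')⁻¹) = y at *
      have e' : k * (x⁻¹ * y) * k⁻¹ = (k * x * k⁻¹)⁻¹ * (k * y * k⁻¹) := by group
      rwa [e'])
  have e1 : A⁻¹ * ((D * (A * 1) * D⁻¹ * (A * 1)⁻¹)⁻¹ * (D * (A * B') * D⁻¹ * (A * B')⁻¹)) *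
      A⁻¹⁻¹ = D * B' * D⁻¹ * B'⁻¹ := by group
  rw [e1, map_mul, map_mul, map_mul, map_inv, map_inv] at h4
  rw [← hfB]
  generalize incl R K B' = b at *
  generalize incl R K D = d at *
  have e2 : k * d * k⁻¹ * (k * b * k⁻¹) * (k * d * k⁻¹)⁻¹ * (k * b * k⁻¹)⁻¹ =
      k * (d * b * d⁻¹ * b⁻¹) * k⁻¹ := by group
  rwa [e2]

/-- `commutator_diag_mem` is applied to the preimages of `N` and `SL₂(R)` under conjugation by
`upper (t / p)`. It asks for normality of `N` only inside `G` because the preimage of `N` need not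
be normal in `SL₂(R)`. -/
theorem conj_diag_mem_germCentralizer {u : Rˣ} {q p : ℕ} (hp : p ≠ 0)
    (hq : ∀ t : R, upper ((q : R) * t) ∈ N) {Q : ℕ} (hQ : Q ≠ 0) (hQ₀ : q * p ^ 2 ∣ Q)
    (hn : (finrank ℚ K).factorial ∣ Q) {w : ℕ}
    (hw : ((q * p ^ 2 : ℕ) : R) ^ 2 ∣ (u : R) ^ w - 1) {ρ : ℤ} (hρQ : IsCoprime ρ (Q : ℤ))
    (hρp : (p : ℤ) ∣ ρ - 1) {M : ℕ}
    (hM : ∀ r : ℕ, r.Prime → (r : ℤ) ≡ ρ [ZMOD (Q ^ 2 : ℕ)] → ∀ d ≤ finrank ℚ K,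
      (∏ i : Fin d, (r ^ d - r ^ (i : ℕ))).gcd w ∣ M) {t : R} (ht : IsCoprime t (p : R)) :
    upper (algebraMap R K t / p) * incl R K (diag (u ^ M)) * (upper (algebraMap R K t / p))⁻¹ ∈
      germCentralizer K N := by
  obtain ⟨k, hk⟩ : ∃ k, k = upper (algebraMap R K t / p) := ⟨_, rfl⟩
  obtain ⟨f, hfapp⟩ : ∃ f : SL(2, R) →* SL(2, K), ∀ X, f X = k * incl R K X * k⁻¹ :=
    ⟨(MulAut.conj k).toMonoidHom.comp (incl R K), fun _ ↦ rfl⟩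
  have hNG : (N.map (incl R K)).comap f ≤ (incl R K).range.comap f :=
    Subgroup.comap_mono (Subgroup.map_le_range _ _)
  have hG' : ∀ g ∈ (incl R K).range.comap f, ∀ x ∈ (N.map (incl R K)).comap f,
      g * x * g⁻¹ ∈ (N.map (incl R K)).comap f := by
    intro g hg x hx
    rw [Subgroup.mem_comap, hfapp] at *
    exact conj_mem_comap_map hg hx
  have hup : ∀ s : R, upper (((q * p ^ 2 : ℕ) : R) * s) ∈ (N.map (incl R K)).comap f := by
    intro s
    rw [Subgroup.mem_comap]
    refine ⟨upper (((q * p ^ 2 : ℕ) : R) * s), ?_, ?_⟩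
    · rw [Nat.cast_mul, mul_assoc]; exact hq _
    · rw [hfapp, map_upper, hk, ← upper_neg, ← upper_add, ← upper_add]
      congr 1
      ring
  have hlow : ∀ s : R, lower (((q * p ^ 2 : ℕ) : R) * s) ∈ (N.map (incl R K)).comap f := by
    intro s
    rw [Subgroup.mem_comap, hfapp, hk]
    exact conj_upper_div_lower_mem hp hq ht s
  have hpQ : (p : R) ^ 2 ∣ (Q : R) := by
    rw [← Nat.cast_pow]
    exact Nat.cast_dvd_cast ((dvd_mul_left _ _).trans hQ₀)
  obtain ⟨x, y, hxy⟩ : IsCoprime ρ ((Q : ℤ) ^ 2) := hρQ.pow_right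
  have hxyR : (x : R) * ρ + y * Q ^ 2 = 1 := by exact_mod_cast congrArg (Int.cast : ℤ → R) hxy
  have hQQ : (Q : R) ∣ (Q : R) ^ 2 := dvd_pow_self _ two_ne_zero
  -- A base point for the coset with first entry `ρ`. As `ρ ≡ 1` modulo `p`, both diagonal entries
  -- are `1` modulo `p`, which keeps the conjugate of `A` integral.
  obtain ⟨A, h00, h01, h10, h11⟩ : ∃ A : SL(2, R), A 0 0 = ρ ∧ A 0 1 = -(Q : R) ∧
      A 1 0 = Q * y ∧ A 1 1 = x :=
    ⟨mk (ρ : R) (-(Q : R)) (Q * y) x (by linear_combination hxyR), rfl, rfl, rfl, rfl⟩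
  have hAG : upper (algebraMap R K t / p) * incl R K A * (upper (algebraMap R K t / p))⁻¹ ∈
      (incl R K).range := by
    refine conj_upper_div_mem_range hp t (h10 ▸ hpQ.mul_right _) ?_
    obtain ⟨z, hz⟩ := hρp
    obtain ⟨z', hz'⟩ := (dvd_pow_self (p : R) two_ne_zero).trans hpQ
    have hzR : (ρ : R) - 1 = p * z := by exact_mod_cast congrArg (Int.cast : ℤ → R) hz
    refine ⟨z + x * z + y * Q * z', ?_⟩
    rw [h00, h11]
    linear_combination (1 + (x : R)) * hzR - hxyR + y * Q * hz'
  refine conj_mem_germCentralizer_of_commutator (m := Q ^ 2) (pow_ne_zero _ hQ) hAG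
    fun B hB hBG ↦ ?_
  rw [← hk] at hAG hBG ⊢
  rw [← hfapp, ← Subgroup.mem_comap] at hAG hBG ⊢
  simp only [mem_principal, Ideal.mem_span_singleton, Nat.cast_pow] at hB
  refine commutator_diag_mem (K := K) hNG hG' hQ hQ₀ hn hup hlow hw hρQ hM
    (Subgroup.mul_mem _ hAG hBG) ?_ ?_ ?_
  · have e : (A * B) 0 0 - (ρ : R) = ρ * (B 0 0 - 1) + -(Q : R) * B 1 0 := by
      rw [mul_00, h00, h01]; ring
    rw [e]
    exact dvd_add (hB.1.mul_left _) (hB.2.2.1.mul_left _)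
  · rw [mul_01, h00, h01]
    exact dvd_add ((hQQ.trans hB.2.1).mul_left _) ((dvd_neg.2 dvd_rfl).mul_right _)
  · rw [mul_10, h10, h11]
    exact dvd_add ((dvd_mul_right _ _).mul_right _) ((hQQ.trans hB.2.2.1).mul_left _)

variable (N K) in
/-- Many conjugates of a diagonal matrix act trivially on a principal congruence subgroup. -/
theorem exists_conj_diag_mem_germCentralizer (u : Rˣ) {q : ℕ} (hq0 : q ≠ 0)
    (hq : ∀ t : R, upper ((q : R) * t) ∈ N) {p : ℕ} (hp : p.Prime) :
    ∃ e : ℕ, ∀ t : R, IsCoprime t (p : R) →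
      upper (algebraMap R K t / p) * incl R K (diag (u ^ ((finrank ℚ K + 1).factorial ^
        (2 * finrank ℚ K * finrank ℚ K) * p ^ e))) * (upper (algebraMap R K t / p))⁻¹ ∈
          germCentralizer K N := by
  have := charZero (R := R) K
  have hn : finrank ℚ K ≠ 0 := finrank_pos.ne'
  have hQ₀ : q * p ^ 2 ≠ 0 := mul_ne_zero hq0 (pow_ne_zero _ hp.ne_zero)
  obtain ⟨w, hw0, hw⟩ := exists_dvd_units_pow_sub_one K u (x := ((q * p ^ 2 : ℕ) : R) ^ 2)
    (pow_ne_zero _ (by exact_mod_cast hQ₀))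
  obtain ⟨W, hWdef⟩ : ∃ W, W = q * p ^ 2 * (finrank ℚ K).factorial * w := ⟨_, rfl⟩
  have hW : W ≠ 0 := by
    rw [hWdef]; exact mul_ne_zero (mul_ne_zero hQ₀ (Nat.factorial_ne_zero _)) hw0
  have hW1 : q * p ^ 2 ∣ W := hWdef ▸ (dvd_mul_right _ _).mul_right _
  have hW2 : (finrank ℚ K).factorial ∣ W := hWdef ▸ (dvd_mul_left _ _).mul_right _
  have hW3 : w ∣ W := hWdef ▸ dvd_mul_left _ _
  have hpW : p ∣ W := (dvd_pow_self p two_ne_zero).trans ((dvd_mul_left _ _).trans hW1)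
  obtain ⟨ρ, hρW, hρp, hρ⟩ := exists_residue hn hW hp hpW
  -- The level is `Q = W ^ (2 * n)` with `n = finrank ℚ K`, so a congruence modulo `Q ^ 2` implies
  -- those modulo `l ^ (2 * n)` for every `l ∣ W`.
  have hWQ : W ∣ W ^ (2 * finrank ℚ K) := dvd_pow_self W (by omega)
  refine ⟨w, fun t ht ↦ conj_diag_mem_germCentralizer hp.ne_zero hq (pow_ne_zero _ hW)
    (hW1.trans hWQ) (hW2.trans hWQ) hw (ρ := ρ)
    (Nat.isCoprime_iff_coprime.2 (hρW.pow_right _)) ?_ ?_ ht⟩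
  · exact (Int.natCast_modEq_iff.2 hρp).symm.dvd
  · intro r hr hmod d hd
    refine hρ r hr (fun l hl hlW ↦ ?_) d hd w hw0 hW3
    exact (Int.natCast_modEq_iff.1 hmod).of_dvd ((pow_dvd_pow_of_dvd hlW _).trans
      (dvd_pow_self _ two_ne_zero))

-- If `f` is a primitive integral polynomial killing `t`, then `t + j` divides `f(-j)`. As `X * f`
-- has degree below `p`, some `j` has `p ∤ j f(-j)`.
variable (K) in
include K in
theorem exists_isCoprime_add {p : ℕ} (hp : p.Prime) (hpn : finrank ℚ K + 1 < p) (t : R) :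
    ∃ j : ℕ, IsCoprime (j : R) (p : R) ∧ IsCoprime (t + j) (p : R) := by
  obtain ⟨f, hf, hdeg, hroot⟩ := exists_isPrimitive_aeval_eq_zero K (algebraMap R K t)
  have hg : (Polynomial.X * f).IsPrimitive := Polynomial.monic_X.isPrimitive.mul hf
  obtain ⟨j, hj⟩ := exists_not_dvd_eval _ hg hp (by
    refine lt_of_le_of_lt (Polynomial.natDegree_mul_le.trans ?_) hpn
    rw [Polynomial.natDegree_X]
    omega) (Q := 1) (by simpa using hp.one_lt.ne')
  simp only [Polynomial.eval_mul, Polynomial.eval_X, Nat.cast_one, neg_one_mul] at hj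
  have hp' := Nat.prime_iff_prime_int.1 hp
  rw [hp'.dvd_mul, not_or, dvd_neg] at hj
  have h1 : IsCoprime ((j : ℤ) : R) ((p : ℤ) : R) :=
    (hp'.coprime_iff_not_dvd.2 hj.1).symm.map (Int.castRingHom R)
  have h2 : IsCoprime ((f.eval (-(j : ℤ)) : ℤ) : R) ((p : ℤ) : R) :=
    (hp'.coprime_iff_not_dvd.2 hj.2).symm.map (Int.castRingHom R)
  rw [Int.cast_natCast] at h1 h2
  refine ⟨j, by simpa using h1, h2.of_isCoprime_of_dvd_left ?_⟩
  obtain ⟨F, hF, hd⟩ := dvd_scaleRoots_eval_sub (K := K) f 1 t j one_ne_zero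
  rw [map_one, div_one, hroot, mul_zero, FaithfulSMul.algebraMap_eq_zero_iff] at hF
  simpa [hF] using hd

variable (N K) in
/-- The germ centralizer contains elementary matrices with large denominators. -/
theorem exists_upper_div_mem_germCentralizer {u : Rˣ} (hu : ∀ j : ℕ, j ≠ 0 → u ^ j ≠ 1) {q : ℕ}
    (hq0 : q ≠ 0) (hq : ∀ t : R, upper ((q : R) * t) ∈ N) :
    ∃ B : ℕ, ∀ p : ℕ, p.Prime → B < p → ∀ t : R,
      upper ((q : K) / p * algebraMap R K t) ∈ germCentralizer K N := by
  have := charZero (R := R) K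
  obtain ⟨M₀, hM₀⟩ : ∃ M, M = (finrank ℚ K + 1).factorial ^ (2 * finrank ℚ K * finrank ℚ K) :=
    ⟨_, rfl⟩
  have hM₀0 : M₀ ≠ 0 := by rw [hM₀]; exact pow_ne_zero _ (Nat.factorial_ne_zero _)
  have hβ : (1 : R) - (u : R) ^ (2 * M₀) ≠ 0 := by
    intro h
    refine hu (2 * M₀) (by omega) ?_
    ext
    push_cast
    linear_combination -h
  obtain ⟨E, hE0, hE⟩ := exists_dvd_natCast K hβ
  refine ⟨max (finrank ℚ K + 1) E, fun p hp hB t ↦ ?_⟩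
  have hp0 : (p : K) ≠ 0 := by exact_mod_cast hp.ne_zero
  obtain ⟨e, he⟩ := exists_conj_diag_mem_germCentralizer K N u hq0 hq hp
  rw [← hM₀] at he
  set β : R := 1 - (u : R) ^ (2 * (M₀ * p ^ e)) with hβdef
  have hdiff : ∀ s : R, upper (algebraMap R K (s * β) / p) ∈ germCentralizer K N := by
    intro s
    obtain ⟨j, hj, hsj⟩ := exists_isCoprime_add K hp ((le_max_left _ _).trans_lt hB) s
    -- The conjugates of one diagonal matrix by `upper ((s + j) / p)` and `upper (j / p)` differ by
    -- a pure unipotent, `upper (s β / p)`.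
    have h := Subgroup.mul_mem _ (he _ hsj) (Subgroup.inv_mem _ (he _ hj))
    convert h using 1
    have e2 : ((u ^ (M₀ * p ^ e) : Rˣ) : R) ^ 2 = 1 - β := by
      rw [hβdef, sub_sub_cancel, Units.val_pow_eq_pow_val, ← pow_mul, mul_comm]
    generalize u ^ (M₀ * p ^ e) = v at *
    set D := incl R K (diag v) with hD
    have e1 : upper (algebraMap R K (s + j) / p) * D * (upper (algebraMap R K (s + j) / p))⁻¹ *
        (upper (algebraMap R K j / p) * D * (upper (algebraMap R K j / p))⁻¹)⁻¹ =
        upper (algebraMap R K (s + j) / p) *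
        (D * (upper (-(algebraMap R K (s + j) / p)) * upper (algebraMap R K j / p)) * D⁻¹) *
        upper (-(algebraMap R K j / p)) := by
      rw [upper_neg, upper_neg]; group
    rw [e1, hD, map_diag, ← upper_add, diag_conj_upper, ← upper_add, ← upper_add]
    congr 1
    have e3 := congrArg (algebraMap R K) e2
    rw [map_pow, map_sub, map_one] at e3
    rw [Units.coe_map, MonoidHom.coe_coe, e3]
    simp only [map_add, map_mul]
    field_simp
    ring
  have hco : IsCoprime β (p : R) := by
    have h1 : IsCoprime (1 - (u : R) ^ (2 * M₀)) (p : R) := by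
      have hpE : IsCoprime (E : ℤ) (p : ℤ) := by
        rw [Nat.isCoprime_iff_coprime]
        exact (Nat.coprime_of_lt_prime hE0 ((le_max_right _ _).trans_lt hB) hp).symm
      have h2 := hpE.map (Int.castRingHom R)
      simp only [eq_intCast, Int.cast_natCast] at h2
      exact h2.of_isCoprime_of_dvd_left hE
    -- Frobenius gives `β ≡ (1 - u ^ (2 M₀)) ^ (p ^ e)` modulo `p`. The base does not depend on `p`,
    -- so it is coprime to every large `p` although `e` varies with `p`.
    obtain ⟨r, hr⟩ := exists_add_pow_prime_pow_eq hp (1 : R) (-(u : R) ^ (2 * M₀)) e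
    have hodd : Odd (p ^ e) := by
      refine (hp.odd_of_ne_two ?_).pow
      have : 0 < finrank ℚ K := finrank_pos
      have := (le_max_left (finrank ℚ K + 1) E).trans_lt hB
      omega
    rw [hodd.neg_pow, one_pow, ← pow_mul, mul_assoc 2] at hr
    have h3 : β = (1 + -(u : R) ^ (2 * M₀)) ^ p ^ e + p * (-(1 * -(u : R) ^ (2 * M₀) * r)) := by
      rw [hβdef]
      linear_combination -hr
    rw [h3]
    refine IsCoprime.add_mul_left_left ?_ _
    rw [← sub_eq_add_neg]
    exact h1.pow_left
  obtain ⟨x, y, hxy⟩ := hco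
  have h4 := Subgroup.mul_mem _ (hdiff (q * t * x)) (incl_mem_germCentralizer (K := K) (hq (t * y)))
  rw [map_upper, ← upper_add] at h4
  convert h4 using 2
  have hxyK := congrArg (algebraMap R K) hxy
  simp only [map_add, map_mul, map_one, map_natCast] at hxyK
  simp only [map_mul, map_natCast]
  field_simp
  linear_combination -(algebraMap R K t) * hxyK

variable (N K) in
/-- The germ centralizer contains a principal congruence subgroup. -/
theorem exists_incl_mem_germCentralizer {u : Rˣ} (hu : ∀ j : ℕ, j ≠ 0 → u ^ j ≠ 1) {q : ℕ}
    (hq0 : q ≠ 0) (hq : ∀ t : R, upper ((q : R) * t) ∈ N) :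
    ∃ m : ℕ, m ≠ 0 ∧ ∀ X ∈ principal (Ideal.span {(m : R)}),
      incl R K X ∈ germCentralizer K N := by
  have := charZero (R := R) K
  obtain ⟨B, hB⟩ := exists_upper_div_mem_germCentralizer K N hu hq0 hq
  obtain ⟨F, hF⟩ : ∃ F, F = (finrank ℚ K).factorial := ⟨_, rfl⟩
  have hQ : q * F ≠ 0 := mul_ne_zero hq0 (hF ▸ Nat.factorial_ne_zero _)
  refine ⟨(q * F) ^ 2, pow_ne_zero _ hQ, fun X hX ↦ ?_⟩
  simp only [mem_principal, Ideal.mem_span_singleton] at hX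
  rw [Nat.cast_pow] at hX
  have hQQ : ((q * F : ℕ) : R) ∣ ((q * F : ℕ) : R) ^ 2 := dvd_pow_self _ two_ne_zero
  obtain ⟨s, t, r, hr, hrB, hmod, h00, h01, h10⟩ := exists_prime_entry K hQ
    (hF ▸ dvd_mul_left _ _) (ρ := 1) isCoprime_one_left (by simpa using hX.1) (hQQ.trans hX.2.1)
    (hQQ.trans hX.2.2.1) B
  set Y := X * upper (((q * F : ℕ) : R) * s) * lower (((q * F : ℕ) : R) * t) with hY
  have hXY : X = Y * (upper (((q * F : ℕ) : R) * s) * lower (((q * F : ℕ) : R) * t))⁻¹ := by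
    rw [hY]; group
  have hE : upper (((q * F : ℕ) : R) * s) * lower (((q * F : ℕ) : R) * t) ∈ N := by
    refine N.mul_mem ?_ ?_ <;> rw [Nat.cast_mul, mul_assoc]
    · exact hq _
    · exact lower_mem hq _
  rw [hXY, map_mul]
  refine Subgroup.mul_mem _ ?_ (incl_mem_germCentralizer (N.inv_mem hE))
  have hr0 : (r : K) ≠ 0 := by exact_mod_cast hr.ne_zero
  have hup := hB r hr hrB
  have hlow := lower_mem_germCentralizer hup
  have hup1 : ∀ z : R, upper ((q : K) * algebraMap R K z) ∈ germCentralizer K N := fun z ↦ by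
    have := incl_mem_germCentralizer (K := K) (hq z)
    rwa [map_upper, map_mul, map_natCast] at this
  have hlow1 := lower_mem_germCentralizer hup1
  obtain ⟨b, hb⟩ := h01
  obtain ⟨c, hc⟩ := h10
  set ξ : Kˣ := (Units.mk0 (r : K) hr0)⁻¹ with hξ
  have hξr : (ξ : K) = (r : K)⁻¹ := by rw [hξ, Units.val_inv_eq_inv_val, Units.val_mk0]
  have hξr' : ((ξ⁻¹ : Kˣ) : K) = r := by rw [hξ, inv_inv, Units.val_mk0]
  obtain ⟨z, hz⟩ := hmod.dvd
  have hzR : (1 : K) - r = (q * F) ^ 2 * z := by exact_mod_cast congrArg (Int.cast : ℤ → K) hz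
  have hdiag : diag ξ ∈ germCentralizer K N := by
    -- From `1 - r = (q F) ^ 2 z` one gets `1 / r = 1 + (q / r) F ^ 2 z * q`, so all four elementary
    -- factors have off-diagonal entries in `qR` or `(q / r)R`.
    rw [diag_eq_of_eq_one_add_mul ξ (p := q / r * algebraMap R K (F ^ 2 * z)) (q := q) (by
      rw [hξr]
      simp only [map_mul, map_pow, map_natCast, map_intCast]
      field_simp
      linear_combination hzR), hξr']
    refine Subgroup.mul_mem _ (Subgroup.mul_mem _ (Subgroup.mul_mem _ ?_ (hup _)) ?_) ?_
    · convert hlow1 (-r) using 2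
      simp
    · convert hlow1 1 using 2
      simp
    · convert hup1 (-(F ^ 2 * z)) using 2
      rw [map_neg]
      field_simp
  have hd := congrArg (algebraMap R K) (det_eq Y)
  have hYdec : incl R K Y = lower (q / r * algebraMap R K (F * c)) * (diag ξ)⁻¹ *
      upper (q / r * algebraMap R K (F * b)) := by
    rw [h00, hb, hc] at hd
    simp only [map_sub, map_mul, map_natCast, map_one, Nat.cast_mul] at hd
    apply ext <;> simp [h00, hb, hc, hξr] <;> field_simp
    linear_combination hd
  rw [hYdec]
  exact Subgroup.mul_mem _ (Subgroup.mul_mem _ (hlow _) (Subgroup.inv_mem _ hdiag)) (hup _)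

variable (K) in
include K in
/-- A normal subgroup of `SL₂(R)` that is not scalar modulo any nonzero prime ideal and
generates the abelianization is everything. -/
theorem eq_top_of_not_scalar {u : Rˣ} (hu : ∀ j : ℕ, j ≠ 0 → u ^ j ≠ 1) (hR : ¬ IsField R)
    (hP : ∀ P : Ideal R, P.IsPrime → P ≠ ⊥ → ∃ X ∈ N,
      ¬ (X 0 1 ∈ P ∧ X 1 0 ∈ P ∧ X 0 0 - X 1 1 ∈ P))
    (hab : N ⊔ commutator SL(2, R) = ⊤) : N = ⊤ := by
  have := charZero (R := R) K
  obtain ⟨P, hP0, hPm⟩ := Ring.not_isField_iff_exists_ideal_bot_lt_and_lt_top.1 hR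
  obtain ⟨P, hPmax, hle⟩ := Ideal.exists_le_maximal P hPm.ne
  obtain ⟨X, hX, hns⟩ := hP P hPmax.isPrime (ne_bot_of_le_ne_bot hP0.ne' hle)
  obtain ⟨Y, hY, hc⟩ := exists_mem_normal_lower_left_notMem hX hns
  obtain ⟨q, hq0, hq⟩ := exists_upper_mem K hu hY (fun h ↦ hc (h ▸ P.zero_mem))
  obtain ⟨m, hm, hcong⟩ := exists_incl_mem_germCentralizer K N hu hq0 hq
  set π := QuotientGroup.mk' N with hπdef
  have hπ : Function.Surjective π := QuotientGroup.mk'_surjective N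
  have hker : π.ker = N := QuotientGroup.ker_mk' N
  have hperf : commutator (SL(2, R) ⧸ N) = ⊤ := by
    have h1 := congrArg (Subgroup.map π) hab
    rw [Subgroup.map_sup, (Subgroup.map_eq_bot_iff _).2 hker.ge, bot_sup_eq, commutator_def,
      Subgroup.map_commutator, ← MonoidHom.range_eq_map, MonoidHom.range_eq_top.2 hπ] at h1
    exact h1
  have htop := map_principal_eq_top π hπ hperf (fun I hI ↦ finite_quotient K hI)
    (by rw [hker]; exact hP)
  have hspan : ∀ k : ℕ, k ≠ 0 → Ideal.span {(k : R)} ≠ ⊥ := fun k hk ↦ by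
    simpa using hk
  -- `SL₂(R) = N Γ(m)`, and both factors lie in the germ centralizer.
  have hall : ∀ g : SL(2, R), incl R K g ∈ germCentralizer K N := by
    intro g
    obtain ⟨x, hx, hxg⟩ : π g ∈ (principal (Ideal.span {(m : R)})).map π := by
      rw [htop _ (hspan m hm)]; trivial
    have h1 : g * x⁻¹ ∈ N := by
      rw [← hker, MonoidHom.mem_ker, map_mul, map_inv, hxg, mul_inv_cancel]
    have h2 := Subgroup.mul_mem _ (incl_mem_germCentralizer (K := K) h1) (hcong x hx)
    rwa [← map_mul, inv_mul_cancel_right] at h2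
  -- The level `k` depends on `g`, but every `Γ(k)` covers the quotient, so the class of `g` is
  -- central.
  have hcomm : commutator (SL(2, R) ⧸ N) = ⊥ := by
    rw [commutator_def, Subgroup.commutator_eq_bot_iff_le_centralizer]
    rintro a - b -
    obtain ⟨g, rfl⟩ := hπ a
    obtain ⟨k, hk, hg⟩ := hall g
    obtain ⟨x, hx, rfl⟩ : b ∈ (principal (Ideal.span {(k : R)})).map π := by
      rw [htop _ (hspan k hk)]; trivial
    obtain ⟨y, hy, he⟩ := hg x hx
    rw [← map_inv, ← map_inv, ← map_mul, ← map_mul, ← map_mul] at he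
    have hy' := incl_injective he
    subst hy'
    replace hy : g * x * g⁻¹ * x⁻¹ ∈ π.ker := hker.symm ▸ hy
    rw [MonoidHom.mem_ker] at hy
    simp only [map_mul, map_inv] at hy
    rw [mul_inv_eq_one, mul_inv_eq_iff_eq_mul] at hy
    exact hy.symm
  rw [hcomm] at hperf
  rw [← hker, MonoidHom.ker_eq_top_iff]
  ext x
  have : π x ∈ (⊥ : Subgroup (SL(2, R) ⧸ N)) := by rw [hperf]; trivial
  simpa using this

end Fraction

end SL2

/-! ### Rings of `S`-integers -/

namespace SInteger

open NumberField IsDedekindDomain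

variable {K : Type*} [Field K]

section FractionRing

variable {A : Type*} [CommRing A] [IsDedekindDomain A] [Algebra A K] [IsFractionRing A K]

instance (S : Set (HeightOneSpectrum A)) : IsFractionRing (S.integer K) K :=
  IsFractionRing.of_field _ K fun z ↦ by
    obtain ⟨x, y, -, h⟩ := IsFractionRing.div_surjective (A := A) z
    exact ⟨algebraMap A _ x, algebraMap A _ y, h.symm⟩

end FractionRing

variable [NumberField K]

/-- A subring of a number field with infinitely many units has a unit of infinite order. -/
theorem exists_unit_of_infinite_order {R : Type*} [CommRing R] [Algebra R K]
    (hinj : Function.Injective (algebraMap R K)) [Infinite Rˣ] :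
    ∃ u : Rˣ, ∀ j : ℕ, j ≠ 0 → u ^ j ≠ 1 := by
  by_contra! h
  -- Torsion units are integral with all absolute values `1`, and there are finitely many such
  -- elements of `K`.
  have hfin := Embeddings.finite_of_norm_le K ℂ 1
  refine Set.infinite_univ.not_finite <| Set.Finite.of_finite_image (hfin.subset ?_)
    ((hinj.comp Units.val_injective).injOn (s := (Set.univ : Set Rˣ)))
  rintro _ ⟨u, -, rfl⟩
  obtain ⟨j, hj, huj⟩ := h u
  have hK : algebraMap R K u ^ j = 1 := by
    rw [← map_pow, ← Units.val_pow_eq_pow_val, huj, Units.val_one, map_one]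
  refine ⟨IsIntegral.of_pow (Nat.pos_of_ne_zero hj) (hK ▸ isIntegral_one), fun φ ↦ ?_⟩
  refine ((pow_eq_one_iff_of_nonneg (norm_nonneg _) hj).1 ?_).le
  rw [← norm_pow, Function.comp_apply, ← map_pow, hK, map_one, norm_one]

theorem not_isUnit_natCast {n : ℕ} (hn : n ≠ 1) : ¬ IsUnit (n : 𝓞 K) := by
  intro h
  have h1 : IsUnit (algebraMap ℤ (𝓞 K) n) := by simpa using h
  have h2 := (algebraMap_isIntegral_iff.2 (inferInstance : Algebra.IsIntegral ℤ (𝓞 K))).isLocalHom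
    (FaithfulSMul.algebraMap_injective ℤ (𝓞 K))
  have h3 := isUnit_of_map_unit (algebraMap ℤ (𝓞 K)) _ h1
  rw [Int.isUnit_iff] at h3
  omega

/-- Euclid's argument: a maximal ideal containing one plus the product of the norms of the primes in
`S`. -/
theorem exists_heightOneSpectrum_notMem {S : Set (HeightOneSpectrum (𝓞 K))} (hS : S.Finite) :
    ∃ v : HeightOneSpectrum (𝓞 K), v ∉ S := by
  obtain ⟨a, ha⟩ : ∃ a, a = ∏ v ∈ hS.toFinset, Ideal.absNorm v.asIdeal := ⟨_, rfl⟩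
  have ha0 : a ≠ 0 := by
    rw [ha, Finset.prod_ne_zero_iff]
    exact fun v _ ↦ by simpa [Ideal.absNorm_eq_zero_iff] using v.ne_bot
  obtain ⟨P, hP, hmem⟩ := exists_max_ideal_of_mem_nonunits (a := ((1 + a : ℕ) : 𝓞 K))
    (not_isUnit_natCast (by omega))
  refine ⟨⟨P, hP.isPrime, fun h ↦ ?_⟩, fun h ↦ ?_⟩
  · rw [h, Ideal.mem_bot] at hmem
    norm_cast at hmem
    omega
  · refine hP.ne_top ((Ideal.eq_top_iff_one _).2 ?_)
    rw [Nat.cast_add, Nat.cast_one] at hmem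
    refine (P.add_mem_iff_left ?_).1 hmem
    obtain ⟨b, hb⟩ := Finset.dvd_prod_of_mem (fun v ↦ Ideal.absNorm v.asIdeal)
      (hS.mem_toFinset.2 h)
    rw [ha, hb, Nat.cast_mul]
    exact P.mul_mem_right _ (Ideal.absNorm_mem P)

theorem not_isField {S : Set (HeightOneSpectrum (𝓞 K))} (hS : S.Finite) :
    ¬ IsField (S.integer K) := by
  intro h
  obtain ⟨v, hv⟩ := exists_heightOneSpectrum_notMem hS
  obtain ⟨a, ha, ha0⟩ := Submodule.exists_mem_ne_zero_of_ne_bot v.ne_bot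
  obtain ⟨b, hb⟩ := h.mul_inv_cancel (a := algebraMap (𝓞 K) (S.integer K) a) (by
    rwa [Ne, FaithfulSMul.algebraMap_eq_zero_iff])
  have hK := congrArg (fun x : S.integer K ↦ v.valuation K x) hb
  simp only [MulMemClass.coe_mul, map_mul, OneMemClass.coe_one, map_one] at hK
  refine hK.not_lt (mul_lt_one_of_lt_of_le ((v.valuation_lt_one_iff_mem a).2 ha) (b.2 v hv))

end SInteger

/-! ### Scalar primes, the abelianization and the conclusion -/

namespace SL2

section ScalarPrimes

variable {R : Type*} [CommRing R]

theorem map_mk_eq_scalar_iff {P : Ideal R} {A : SL(2, R)} :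
    (∃ c : R ⧸ P, (Matrix.SpecialLinearGroup.map (Ideal.Quotient.mk P) A :
      Matrix (Fin 2) (Fin 2) (R ⧸ P)) = Matrix.scalar (Fin 2) c) ↔
      A 0 1 ∈ P ∧ A 1 0 ∈ P ∧ A 0 0 - A 1 1 ∈ P := by
  simp only [← Matrix.ext_iff, Fin.forall_fin_two, map_entry, ← Ideal.Quotient.eq_zero_iff_mem,
    map_sub, sub_eq_zero]
  constructor
  · rintro ⟨c, h⟩
    simp at h
    exact ⟨h.1.2, h.2.1, h.1.1.trans h.2.2.symm⟩
  · rintro ⟨h1, h2, h3⟩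
    exact ⟨Ideal.Quotient.mk P (A 1 1), by simp [h1, h2, h3]⟩

/-- The elements of `SL₂(R)` that are scalar modulo `P`. -/
def scalarModulo (P : Ideal R) : Subgroup SL(2, R) :=
  (Subgroup.center SL(2, R ⧸ P)).comap (Matrix.SpecialLinearGroup.map (Ideal.Quotient.mk P))

theorem mem_scalarModulo {P : Ideal R} {A : SL(2, R)} : A ∈ scalarModulo P ↔
      A 0 1 ∈ P ∧ A 1 0 ∈ P ∧ A 0 0 - A 1 1 ∈ P := by
  rw [← map_mk_eq_scalar_iff, scalarModulo, Subgroup.mem_comap,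
    Matrix.SpecialLinearGroup.mem_center_iff]
  refine ⟨fun ⟨c, _, h⟩ ↦ ⟨c, h.symm⟩, fun ⟨c, h⟩ ↦ ⟨c, ?_, h.symm⟩⟩
  have := congrArg Matrix.det h
  rwa [Matrix.SpecialLinearGroup.det_coe, Matrix.scalar_apply, Matrix.det_diagonal,
    Finset.prod_const, Finset.card_univ, eq_comm] at this

instance (P : Ideal R) : (scalarModulo P).Normal :=
  inferInstanceAs (Subgroup.Normal (Subgroup.comap _ _))

theorem scalarPrimes_eq_empty {T : Set SL(2, R)} (hT : Subgroup.normalClosure T = ⊤) :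
    scalarPrimes T = ∅ := by
  rw [Set.eq_empty_iff_forall_notMem]
  rintro P ⟨hP, -, h⟩
  have h1 : Subgroup.normalClosure T ≤ scalarModulo P :=
    Subgroup.normalClosure_le_normal fun A hA ↦
      mem_scalarModulo.2 (map_mk_eq_scalar_iff.1 (h A hA))
  have h2 : upper 1 ∈ scalarModulo P := h1 (hT ▸ Subgroup.mem_top _)
  exact hP.one_notMem (mem_scalarModulo.1 h2).1

end ScalarPrimes

end SL2

theorem Abelianization.closure_image_of_eq_top_iff {G : Type*} [Group G] (T : Set G) :
    Subgroup.closure ((Abelianization.of : G →* _) '' T) = ⊤ ↔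
      Subgroup.normalClosure T ⊔ commutator G = ⊤ := by
  have hof : Function.Surjective (Abelianization.of : G →* _) := QuotientGroup.mk_surjective
  have h : (Subgroup.normalClosure T).map (Abelianization.of : G →* _) =
      Subgroup.closure (Abelianization.of '' T) := by
    refine le_antisymm ?_ ?_
    · rw [Subgroup.map_le_iff_le_comap]
      exact Subgroup.normalClosure_le_normal fun x hx ↦
        Subgroup.subset_closure (Set.mem_image_of_mem _ hx)
    · rw [← MonoidHom.map_closure]
      exact Subgroup.map_mono Subgroup.closure_le_normalClosure
  rw [← h, ← Abelianization.ker_of, ← Subgroup.comap_map_eq]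
  exact ⟨fun e ↦ by rw [e, Subgroup.comap_top], fun e ↦ by
    rw [← Subgroup.map_comap_eq_self_of_surjective hof (Subgroup.map _ _), e,
      Subgroup.map_top_of_surjective _ hof]⟩

theorem corollary3 {K : Type*} [Field K] [NumberField K]
    (S : Set (IsDedekindDomain.HeightOneSpectrum (NumberField.RingOfIntegers K)))
    (hS : S.Finite) (hunits : Infinite (S.integer K)ˣ)
    (T : Set SL(2, S.integer K)) :
    NormallyGenerates T ↔
      scalarPrimes T = ∅ ∧
        Subgroup.closure ((Abelianization.of : SL(2, S.integer K) →* _) '' T) = ⊤ := by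
  rw [Abelianization.closure_image_of_eq_top_iff]
  refine ⟨fun h ↦ ⟨SL2.scalarPrimes_eq_empty h, ?_⟩, fun ⟨hT, hab⟩ ↦ ?_⟩
  · rw [NormallyGenerates] at h
    rw [h, top_sup_eq]
  · obtain ⟨u, hu⟩ := SInteger.exists_unit_of_infinite_order (R := S.integer K) (K := K)
      (FaithfulSMul.algebraMap_injective _ _)
    refine SL2.eq_top_of_not_scalar K hu (SInteger.not_isField hS) (fun P hP hP0 ↦ ?_) hab
    by_contra! h
    refine (Set.eq_empty_iff_forall_notMem.1 hT) P ⟨hP, hP0, fun A hA ↦ ?_⟩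
    exact SL2.map_mk_eq_scalar_iff.2 (h A (Subgroup.subset_normalClosure hA))
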